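/- **Setting.** Let $L\ge 0$, let $f_1,\dots,f_L$ be fermionic annihilation operators on the Fock space with vacuum $|0\rangle$ and orthonormal occupation basis $|x\rangle=(f_1^\dagger)^{x_1}\cdots(f_L^\dagger)^{x_L}|0\rangle$, $x\in\{0,1\}^L$, and let $\gamma_{2k-1}=f_k+f_k^\dagger$, $\gamma_{2k}=-i(f_k-f_k^\dagger)$. For real antisymmetric $G\in\mathbb R^{2L\times 2L}$ put $U_G=e^{-iH(G)}$ with $H(G)=\frac i4\sum_{j,k}G_{jk}\gamma_j\gamma_k$. An (even) fermionic Gaussian state vector is a vector $U_G|0\rangle$; more generally, $U_G|w\rangle$ is called Gaussian with reference $|w\rangle$. For $z\in\{0,1\}^L$ the $z$-offset basis is $|x\rangle_z=(\gamma_{2L-1})^{x_L}\cdots(\gamma_1)^{x_1}|z\rangle$, and the amplitude tensor of $\psi$ in it is $T(x)={}_z\langle x|\psi\rangle$. Let $c_{k}^{(z)}=f_k^\dagger$ if $z_k=0$ and $c_k^{(z)}=f_k$ if $z_k=1$. For a complex antisymmetric $L\times L$ matrix $A$, $A_{|x}$ is the principal submatrix on the indices $k$ with $x_k=1$, and $\mathrm{Pf}$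 is the Pfaffian. A tensor $T:\{0,1\}^L\to\mathbb C$ is a matchgate (with generating matrix $A$ and reference index $y$) if $T(x)=\mathrm{Pf}(A_{|x\oplus y})\,T(y)$ for all $x$, for some $y$ and some antisymmetric $A$; it is even if $T(x)=0$ whenever $\sum_j x_j$ is odd. **Lemma (Matchgates and Gaussian states).** 1. Let $|\psi\rangle=U_G|0\rangle$. There is a $z$ with $\langle z|\psi\rangle\ne0$, and for every such $z$ the amplitude tensor $T$ of $\psi$ in the $z$-offset basis, $|\psi\rangle=\sum_xT(x)|x\rangle_z$, has $T(0)\neq 0$ and is a matchgate with reference index $0$: there is an antisymmetric $A\in\mathbb C^{L\times L}$ with $T(x)=T(0)\,\mathrm{Pf}(A_{|x})$ for all $x$, and $|\psi\rangle=\langle z|\psi\rangle\exp\bigl(-\tfrac12\sum_{j,k}A_{jk}c^{(z)}_jc^{(z)}_k\bigr)|z\rangle$. 2. The two forms are equivalent: for every $z$, every vector $\psi$ with $z$-offset amplitude tensor $T$, and every antisymmetric $A$, one has $T(x)=T(0)\,\mathrm{Pf}(A_{|x})$ for all $x$ if and only if $|\psi\rangle=\langle z|\psi\rangle\exp\bigl(-\tfrac12\sum_{j,k}A_{jk}c^{(z)}_jc^{(z)}_k\bigr)|z\rangle$.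 Likewise, in the occupation basis, $\langle x|\psi\rangle=\langle 0|\psi\rangle\,\mathrm{Pf}(A_{|x})$ for all $x$ if and only if $|\psi\rangle=\langle0|\psi\rangle\exp\bigl(\tfrac12\sum_{j,k}A_{jk}f_j^\dagger f_k^\dagger\bigr)|0\rangle$. 3. Conversely, let $T\neq0$ satisfy $T(x)=T(0)\,\mathrm{Pf}(A_{|x})$ for some antisymmetric $A$, and let $z,w\in\{0,1\}^L$ have weights of the same parity. Then $\sum_xT(x)|x\rangle_z$ is a nonzero scalar multiple of a Gaussian state vector with reference $|w\rangle$; in particular, if $z$ has even weight, it is a nonzero multiple of some $U_G|0\rangle$. 4. In the occupation basis: a tensor $T\neq0$ is an even matchgate tensor if and only if $\sum_xT(x)|x\rangle$ is a nonzero scalar multiple of some Gaussian state vector $U_G|0\rangle$. -/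

import Mathlib

open scoped Matrix

noncomputable section

namespace Matchgate

/-- Bit strings in `{0,1}^L`; `x k = true` means `x_k = 1` (the `k`-th mode is occupied). -/
abbrev Bits (L : ℕ) : Type := Fin L → Bool

/-- The all-zero bit string. -/
def zeros (L : ℕ) : Bits L := fun _ => false

/-- The set of positions at which the bit string is `1`. -/
def supp {L : ℕ} (x : Bits L) : Finset (Fin L) := Finset.univ.filter (fun k => x k = true)

/-- The Hamming weight (particle number) of a bit string. -/
def weight {L : ℕ} (x : Bits L) : ℕ := (supp x).card

/-- Bitwise XOR. -/
def bxor {L : ℕ} (x z : Bits L) : Bits L := fun k => xor (x k) (z k)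

/-- A tensor of rank `L`, all of whose indices take values in `{0,1}`. -/
abbrev Tensor (L : ℕ) : Type := Bits L → ℂ

/-! ### Pfaffians and matchgate tensors -/

/-- The Pfaffian of an antisymmetric `n × n` matrix, by expansion along the first row:
`Pf A = ∑_{j ≥ 2} (-1)^j A_{1,j} Pf A_{\hat 1, \hat j}` (indices starting at 1), where the rows and
columns `1` and `j` are deleted. It is `1` for `n = 0` and `0` for odd `n`. -/
def pf : (n : ℕ) → Matrix (Fin n) (Fin n) ℂ → ℂ
  | 0, _ => 1
  | 1, _ => 0
  | n + 2, A => ∑ j : Fin (n + 1), (-1 : ℂ) ^ (j : ℕ) * A 0 j.succ *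
      pf n (A.submatrix (fun i => (j.succAbove i).succ) (fun i => (j.succAbove i).succ))

/-- `Pf (A_{|x})`: the Pfaffian of the principal submatrix of `A` on the rows and columns `k` with
`x_k = 1`, taken in increasing order. -/
def pfAt {L : ℕ} (A : Matrix (Fin L) (Fin L) ℂ) (x : Bits L) : ℂ :=
  pf (supp x).card
    (A.submatrix ((supp x).orderEmbOfFin rfl) ((supp x).orderEmbOfFin rfl))

/-- `T` is a matchgate with generating matrix `A` and reference index `z`. -/
def IsMatchgateWith {L : ℕ} (A : Matrix (Fin L) (Fin L) ℂ) (z : Bits L) (T : Tensor L) : Prop :=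
  Aᵀ = -A ∧ ∀ x, T x = pfAt A (bxor x z) * T z

/-- `T` is a matchgate tensor. -/
def IsMatchgate {L : ℕ} (T : Tensor L) : Prop :=
  ∃ (z : Bits L) (A : Matrix (Fin L) (Fin L) ℂ), IsMatchgateWith A z T

/-- `T` is an even tensor: it vanishes on all bit strings of odd weight. -/
def IsEvenTensor {L : ℕ} (T : Tensor L) : Prop :=
  ∀ x, Odd (weight x) → T x = 0

/-! ### The Fock space of `L` fermionic modes -/

/-- State vectors of `L` fermionic modes, in coordinates of the orthonormal occupation basis. -/
abbrev Vec (L : ℕ) : Type := Bits L → ℂ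

/-- Linear operators on the Fock space, as matrices in the occupation basis. -/
abbrev Op (L : ℕ) : Type := Matrix (Bits L) (Bits L) ℂ

/-- The occupation basis vector `|x⟩`. -/
def ket {L : ℕ} (x : Bits L) : Vec L := Pi.single x 1

/-- The inner product `⟨φ|ψ⟩`, antilinear in the first argument. -/
def braket {L : ℕ} (φ ψ : Vec L) : ℂ := star φ ⬝ᵥ ψ

/-- The Jordan-Wigner sign `(-1)^{x_1 + ⋯ + x_{k-1}}`. -/
def jwSign {L : ℕ} (k : Fin L) (x : Bits L) : ℂ :=
  (-1) ^ ((supp x).filter (fun j => j < k)).card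

/-- The annihilation operator `f_k`: it maps `|x⟩` to `(-1)^{x_1 + ⋯ + x_{k-1}} |x - e^k⟩` if
`x_k = 1` and to `0` if `x_k = 0`. With this sign,
`|x⟩ = (f†_1)^{x_1} ⋯ (f†_L)^{x_L} |0⟩`. -/
def annih {L : ℕ} (k : Fin L) : Op L :=
  Matrix.of fun y x => if x k = true ∧ y = Function.update x k false then jwSign k x else 0

/-- The creation operator `f†_k`. -/
def create {L : ℕ} (k : Fin L) : Op L := (annih k)ᴴ

/-- The Majorana operators: `majorana (k, 0)` is `γ_{2k-1} = f_k + f†_k` and `majorana (k, 1)` is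
`γ_{2k} = -i (f_k - f†_k)`. -/
def majorana {L : ℕ} (p : Fin L × Fin 2) : Op L :=
  if p.2 = 0 then annih p.1 + create p.1
  else (-Complex.I) • (annih p.1 - create p.1)

/-- The quadratic Hamiltonian `H(G) = (i/4) ∑_{p,q} G_{p,q} γ_p γ_q`. -/
def quadHam {L : ℕ} (G : Matrix (Fin L × Fin 2) (Fin L × Fin 2) ℝ) : Op L :=
  (Complex.I / 4) • ∑ p, ∑ q, (G p q : ℂ) • (majorana p * majorana q)

/-- The Gaussian unitary `U_G = exp(-i H(G))`. -/
def gaussianUnitary {L : ℕ} (G : Matrix (Fin L × Fin 2) (Fin L × Fin 2) ℝ) : Op L :=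
  NormedSpace.exp ((-Complex.I) • quadHam G)

/-- `ψ = U_G |w⟩` for some real antisymmetric `G`: a Gaussian state vector with reference `|w⟩`. -/
def IsGaussianFrom {L : ℕ} (w : Bits L) (ψ : Vec L) : Prop :=
  ∃ G : Matrix (Fin L × Fin 2) (Fin L × Fin 2) ℝ,
    Gᵀ = -G ∧ ψ = gaussianUnitary G *ᵥ ket w

/-- Even fermionic Gaussian state vectors `ψ = U_G |0⟩`, with the vacuum as reference. -/
def IsGaussian {L : ℕ} (ψ : Vec L) : Prop := IsGaussianFrom (zeros L) ψ

/-! ### The `z`-offset basis -/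

/-- The `z`-offset basis vector `|x⟩_z = (γ_{2L-1})^{x_L} ⋯ (γ_1)^{x_1} |z⟩`. -/
def offsetKet {L : ℕ} (z x : Bits L) : Vec L :=
  ((List.finRange L).reverse.map
    (fun k => if x k = true then majorana (k, 0) else 1)).prod *ᵥ ket z

/-- The amplitude tensor `T(x) = ⟨x|_z |ψ⟩` of `ψ` in the `z`-offset basis. -/
def offsetTensor {L : ℕ} (z : Bits L) (ψ : Vec L) : Tensor L :=
  fun x => braket (offsetKet z x) ψ

/-- The operator that creates an excitation of mode `k` above the reference `|z⟩`: it is `f†_k` if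
`z_k = 0` and `f_k` if `z_k = 1`. -/
def createAt {L : ℕ} (z : Bits L) (k : Fin L) : Op L :=
  if z k = true then annih k else create k

/-- The quadratic form `(1/2) ∑_{j,k} A_{j,k} c_j c_k` in operators `c_1, …, c_L`. -/
def quadForm {L : ℕ} (A : Matrix (Fin L) (Fin L) ℂ) (c : Fin L → Op L) : Op L :=
  (1 / 2 : ℂ) • ∑ j, ∑ k, A j k • (c j * c k)

end Matchgate

end

namespace Matchgate

variable {L : ℕ}

/-! ### Bit flips and signs -/

/-- Flip the `k`-th bit. -/
def flip (k : Fin L) (x : Bits L) : Bits L := Function.update x k (!x k)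

@[simp] theorem flip_same (k : Fin L) (x : Bits L) : flip k x k = !x k := by simp [flip]

theorem flip_of_ne {j k : Fin L} (h : j ≠ k) (x : Bits L) : flip k x j = x j := by
  simp [flip, h]

@[simp] theorem flip_flip (k : Fin L) (x : Bits L) : flip k (flip k x) = x := by
  simp [flip]

theorem flip_comm (j k : Fin L) (x : Bits L) : flip j (flip k x) = flip k (flip j x) := by
  funext i
  by_cases hj : i = j <;> by_cases hk : i = k <;> subst_vars <;> simp_all [flip]

theorem flip_bxor (k : Fin L) (x z : Bits L) : bxor (flip k x) z = flip k (bxor x z) := by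
  funext i
  by_cases h : i = k
  · subst h; simp [bxor]
  · simp [bxor, flip_of_ne h]

@[simp] theorem bxor_bxor_cancel (x z : Bits L) : bxor (bxor x z) z = x := by
  funext i; simp [bxor]

@[simp] theorem bxor_zeros (x : Bits L) : bxor x (zeros L) = x := by
  funext i; simp [bxor, zeros]

@[simp] theorem zeros_bxor (x : Bits L) : bxor (zeros L) x = x := by
  funext i; simp [bxor, zeros]

theorem bxor_eq_iff {x y z : Bits L} : bxor x z = y ↔ x = bxor y z := by
  constructor <;> rintro rfl <;> simp

@[simp] theorem supp_zeros : supp (zeros L) = ∅ := by simp [supp, zeros]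

@[simp] theorem weight_zeros : weight (zeros L) = 0 := by simp [weight]

theorem mem_supp {x : Bits L} {k : Fin L} : k ∈ supp x ↔ x k = true := by simp [supp]

theorem jwSign_eq_prod (k : Fin L) (x : Bits L) :
    jwSign k x = ∏ j, if j < k ∧ x j = true then (-1 : ℂ) else 1 := by
  rw [jwSign, ← Finset.prod_const, supp, Finset.filter_filter, Finset.prod_filter]
  simp [and_comm]

theorem jwSign_congr {k : Fin L} {x y : Bits L} (h : ∀ j < k, x j = y j) :
    jwSign k x = jwSign k y := by
  simp only [jwSign_eq_prod]
  refine Finset.prod_congr rfl fun j _ => ?_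
  by_cases hj : j < k <;> simp [hj, h]

theorem jwSign_bxor (k : Fin L) (x z : Bits L) :
    jwSign k (bxor x z) = jwSign k x * jwSign k z := by
  simp only [jwSign_eq_prod, ← Finset.prod_mul_distrib]
  refine Finset.prod_congr rfl fun j _ => ?_
  by_cases hj : j < k <;> cases hx : x j <;> cases hz : z j <;> simp [bxor, *]

@[simp] theorem jwSign_mul_self (k : Fin L) (x : Bits L) : jwSign k x * jwSign k x = 1 := by
  rw [jwSign, ← mul_pow]; simp

@[simp] theorem star_jwSign (k : Fin L) (x : Bits L) : star (jwSign k x) = jwSign k x := by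
  simp [jwSign]

@[simp] theorem jwSign_zeros (k : Fin L) : jwSign k (zeros L) = 1 := by simp [jwSign]

theorem jwSign_flip_of_le {j k : Fin L} (h : k ≤ j) (x : Bits L) :
    jwSign k (flip j x) = jwSign k x :=
  jwSign_congr fun _ hi => flip_of_ne (hi.trans_le h).ne x

@[simp] theorem jwSign_flip_self (k : Fin L) (x : Bits L) : jwSign k (flip k x) = jwSign k x :=
  jwSign_flip_of_le le_rfl x

theorem jwSign_flip_of_lt {j k : Fin L} (h : j < k) (x : Bits L) :
    jwSign k (flip j x) = -jwSign k x := by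
  simp only [jwSign_eq_prod]
  rw [← Finset.mul_prod_erase _ _ (Finset.mem_univ j),
    ← Finset.mul_prod_erase _ _ (Finset.mem_univ j), ← neg_mul]
  congr 1
  · cases hx : x j <;> simp [h, hx]
  · refine Finset.prod_congr rfl fun i hi => ?_
    rw [flip_of_ne (Finset.ne_of_mem_erase hi)]

/-! ### Action of the field operators on amplitudes -/

theorem update_true_eq_flip {k : Fin L} {x : Bits L} (h : x k = false) :
    Function.update x k true = flip k x := by simp [flip, h]

theorem update_false_eq_flip {k : Fin L} {x : Bits L} (h : x k = true) :
    Function.update x k false = flip k x := by simp [flip, h]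

theorem annih_apply (k : Fin L) (y x : Bits L) :
    (annih k : Op L) y x = if y k = false ∧ x = flip k y then jwSign k y else 0 := by
  rw [annih, Matrix.of_apply]
  have : (x k = true ∧ y = Function.update x k false) ↔ (y k = false ∧ x = flip k y) := by
    constructor
    · rintro ⟨h, rfl⟩
      rw [update_false_eq_flip h]; simp [h]
    · rintro ⟨h, rfl⟩
      simp [h, update_false_eq_flip]
  simp only [this]
  split_ifs with h
  · rw [h.2]; simp
  · rfl

theorem create_apply (k : Fin L) (y x : Bits L) :
    (create k : Op L) y x = if y k = true ∧ x = flip k y then jwSign k y else 0 := by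
  rw [create, Matrix.conjTranspose_apply, annih_apply]
  have : (x k = false ∧ y = flip k x) ↔ (y k = true ∧ x = flip k y) := by
    constructor <;> rintro ⟨h, rfl⟩ <;> simp [h]
  simp only [this]
  split_ifs with h
  · rw [h.2]; simp
  · simp

theorem annih_mulVec (k : Fin L) (ψ : Vec L) (y : Bits L) :
    (annih k *ᵥ ψ) y = if y k = false then jwSign k y * ψ (flip k y) else 0 := by
  simp only [Matrix.mulVec, dotProduct, annih_apply]
  by_cases h : y k = false <;> simp [h]

theorem create_mulVec (k : Fin L) (ψ : Vec L) (y : Bits L) :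
    (create k *ᵥ ψ) y = if y k = true then jwSign k y * ψ (flip k y) else 0 := by
  simp only [Matrix.mulVec, dotProduct, create_apply]
  by_cases h : y k = true <;> simp [h]

/-- The phase with which `majorana p` acts at the amplitude `y`, up to the Jordan-Wigner sign. -/
def phase (p : Fin L × Fin 2) (y : Bits L) : ℂ :=
  if p.2 = 0 then 1 else if y p.1 = true then Complex.I else -Complex.I

theorem majorana_mulVec (p : Fin L × Fin 2) (ψ : Vec L) (y : Bits L) :
    (majorana p *ᵥ ψ) y = phase p y * (jwSign p.1 y * ψ (flip p.1 y)) := by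
  unfold majorana phase
  split_ifs with h h'
  · rw [Matrix.add_mulVec, Pi.add_apply, annih_mulVec, create_mulVec]
    cases hy : y p.1 <;> simp
  · rw [Matrix.smul_mulVec, Matrix.sub_mulVec, Pi.smul_apply, Pi.sub_apply, annih_mulVec,
      create_mulVec]
    simp [h']
  · rw [Matrix.smul_mulVec, Matrix.sub_mulVec, Pi.smul_apply, Pi.sub_apply, annih_mulVec,
      create_mulVec]
    simp [h']

theorem op_ext {A B : Op L} (h : ∀ ψ y, (A *ᵥ ψ) y = (B *ᵥ ψ) y) : A = B :=
  Matrix.mulVec_injective (funext fun ψ => funext (h ψ))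

theorem phase_flip_of_ne {p : Fin L × Fin 2} {k : Fin L} (h : p.1 ≠ k) (y : Bits L) :
    phase p (flip k y) = phase p y := by
  simp [phase, flip_of_ne h]

/-- The canonical anticommutation relations of the Majorana operators. -/
theorem majorana_anticomm (p q : Fin L × Fin 2) :
    majorana p * majorana q + majorana q * majorana p = if p = q then (2 : Op L) else 0 := by
  refine op_ext fun ψ y => ?_
  simp only [Matrix.add_mulVec, Pi.add_apply, ← Matrix.mulVec_mulVec, majorana_mulVec]
  obtain ⟨j, a⟩ := p
  obtain ⟨k, b⟩ := q
  by_cases hjk : j = k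
  · subst hjk
    have h2 : ((2 : Op L) *ᵥ ψ) y = 2 * ψ y := by
      rw [show (2 : Op L) = 1 + 1 by norm_num, Matrix.add_mulVec]; simp; ring
    have e (a b : ℂ) : a * (jwSign j y * (b * (jwSign j y * ψ y))) = a * b * ψ y := by
      linear_combination (a * b * ψ y) * jwSign_mul_self j y
    simp only [jwSign_flip_self, flip_flip, e]
    fin_cases a <;> fin_cases b <;> cases hy : y j <;> simp [phase, hy, h2] <;> ring
  · have hne : ((j, a) : Fin L × Fin 2) ≠ (k, b) := fun h => hjk (congrArg Prod.fst h)
    rw [if_neg hne, phase_flip_of_ne (Ne.symm hjk), phase_flip_of_ne hjk, flip_comm k j]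
    simp only [Matrix.zero_mulVec, Pi.zero_apply]
    rcases lt_or_gt_of_ne hjk with h | h
    · rw [jwSign_flip_of_lt h, jwSign_flip_of_le h.le]; ring
    · rw [jwSign_flip_of_lt h, jwSign_flip_of_le h.le]; ring

theorem majorana_zero (k : Fin L) : (majorana (k, 0) : Op L) = annih k + create k := by
  simp [majorana]

theorem majorana_one (k : Fin L) :
    (majorana (k, 1) : Op L) = (-Complex.I) • (annih k - create k) := by
  simp [majorana]

theorem annih_eq (k : Fin L) :
    (annih k : Op L) = (1 / 2 : ℂ) • majorana (k, 0) + (Complex.I / 2) • majorana (k, 1) := by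
  rw [majorana_zero, majorana_one, smul_smul,
    show Complex.I / 2 * -Complex.I = 1 / 2 by linear_combination (-1 / 2) * Complex.I_mul_I]
  module

theorem create_eq (k : Fin L) :
    (create k : Op L) = (1 / 2 : ℂ) • majorana (k, 0) - (Complex.I / 2) • majorana (k, 1) := by
  rw [majorana_zero, majorana_one, smul_smul,
    show Complex.I / 2 * -Complex.I = 1 / 2 by linear_combination (-1 / 2) * Complex.I_mul_I]
  module

/-! ### Vacuum -/

theorem eq_smul_vacuum {ψ : Vec L} (h : ∀ k, annih k *ᵥ ψ = 0) :
    ψ = ψ (zeros L) • ket (zeros L) := by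
  funext y
  by_cases hy : y = zeros L
  · subst hy; simp [ket]
  · obtain ⟨k, hk⟩ := Function.ne_iff.1 hy
    have hk' : y k = true := by simpa [zeros] using hk
    have := congrFun (h k) (flip k y)
    rw [annih_mulVec] at this
    have h1 : jwSign k y ≠ 0 := fun h0 => by simpa [h0] using jwSign_mul_self k y
    simp [hk', h1] at this
    simp [ket, hy, this]

theorem annih_vacuum (k : Fin L) : annih k *ᵥ ket (zeros L) = 0 := by
  funext y
  rw [annih_mulVec]
  split_ifs with h
  · have : flip k y ≠ zeros L := fun h0 => by
      have := congrFun h0 k; simp [h, zeros] at this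
    simp [ket, this]
  · rfl

theorem braket_ket (x : Bits L) (ψ : Vec L) : braket (ket x) ψ = ψ x := by
  simp [braket, ket, dotProduct, Pi.single_apply, apply_ite]

/-! ### The particle-hole transformation -/

/-- The sign `∏_{k : x_k = 1} jwSign k z`. -/
def refSign (z x : Bits L) : ℂ := ∏ k, if x k = true then jwSign k z else 1

@[simp] theorem refSign_mul_self (z x : Bits L) : refSign z x * refSign z x = 1 := by
  rw [refSign, ← Finset.prod_mul_distrib]
  refine Finset.prod_eq_one fun k _ => ?_
  split_ifs <;> simp

@[simp] theorem star_refSign (z x : Bits L) : star (refSign z x) = refSign z x := by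
  rw [refSign, star_prod]
  refine Finset.prod_congr rfl fun k _ => ?_
  split_ifs <;> simp

@[simp] theorem refSign_zeros_right (z : Bits L) : refSign z (zeros L) = 1 := by
  simp [refSign, zeros]

theorem refSign_flip (z x : Bits L) (k : Fin L) :
    refSign z (flip k x) = jwSign k z * refSign z x := by
  simp only [refSign]
  rw [← Finset.mul_prod_erase _ _ (Finset.mem_univ k),
    ← Finset.mul_prod_erase _ (fun i => if x i = true then _ else _) (Finset.mem_univ k),
    ← mul_assoc]
  congr 1
  · cases hx : x k <;> simp [hx]
  · refine Finset.prod_congr rfl fun i hi => ?_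
    rw [flip_of_ne (Finset.ne_of_mem_erase hi)]

/-- The particle-hole transformation that maps the vacuum to `|z⟩` and `f†_k` to `createAt z k`. -/
def shiftOp (z : Bits L) : Op L :=
  Matrix.of fun y x => if x = bxor y z then refSign z x else 0

theorem shiftOp_mulVec (z : Bits L) (ψ : Vec L) (y : Bits L) :
    (shiftOp z *ᵥ ψ) y = refSign z (bxor y z) * ψ (bxor y z) := by
  simp [Matrix.mulVec, dotProduct, shiftOp]

theorem shiftOp_conjTranspose_mulVec (z : Bits L) (ψ : Vec L) (y : Bits L) :
    ((shiftOp z)ᴴ *ᵥ ψ) y = refSign z y * ψ (bxor y z) := by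
  have h : ∀ x, (y = bxor x z) ↔ (x = bxor y z) := fun x => by
    rw [eq_comm, bxor_eq_iff]
  simp [Matrix.mulVec, dotProduct, shiftOp, Matrix.conjTranspose_apply, h, apply_ite]

theorem shiftOp_mul_conjTranspose (z : Bits L) : shiftOp z * (shiftOp z)ᴴ = 1 := by
  refine op_ext fun ψ y => ?_
  rw [← Matrix.mulVec_mulVec, shiftOp_mulVec, shiftOp_conjTranspose_mulVec, ← mul_assoc]
  simp

theorem conjTranspose_mul_shiftOp (z : Bits L) : (shiftOp z)ᴴ * shiftOp z = 1 :=
  mul_eq_one_comm.1 (shiftOp_mul_conjTranspose z)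

theorem shiftOp_mulVec_ket (z x : Bits L) :
    shiftOp z *ᵥ ket x = refSign z x • ket (bxor x z) := by
  funext y
  rw [shiftOp_mulVec]
  by_cases h : bxor y z = x
  · have h' : y = bxor x z := bxor_eq_iff.1 h
    simp [ket, h, h']
  · have h' : y ≠ bxor x z := fun h0 => h (bxor_eq_iff.2 h0)
    simp [ket, h, h']

theorem shiftOp_vacuum (z : Bits L) : shiftOp z *ᵥ ket (zeros L) = ket z := by
  simp [shiftOp_mulVec_ket]

theorem shiftOp_mul_create (z : Bits L) (k : Fin L) :
    shiftOp z * create k = createAt z k * shiftOp z := by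
  refine op_ext fun ψ y => ?_
  rw [← Matrix.mulVec_mulVec, ← Matrix.mulVec_mulVec, shiftOp_mulVec, create_mulVec, createAt]
  have h := jwSign_mul_self k z
  have hb : bxor y z k = xor (y k) (z k) := rfl
  have e : jwSign k (bxor y z) * (refSign z (bxor y z) * ψ (flip k (bxor y z))) =
      jwSign k y * (shiftOp z *ᵥ ψ) (flip k y) := by
    rw [shiftOp_mulVec, flip_bxor, refSign_flip, jwSign_bxor]; ring
  rw [mul_ite, mul_zero, mul_left_comm, e, hb]
  cases hz : z k <;> cases hy : y k <;> simp [annih_mulVec, create_mulVec, hy]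

theorem shiftOp_mul_annih (z : Bits L) (k : Fin L) :
    shiftOp z * annih k = (createAt z k)ᴴ * shiftOp z := by
  have h := congrArg Matrix.conjTranspose (shiftOp_mul_create z k)
  rw [Matrix.conjTranspose_mul, Matrix.conjTranspose_mul, create,
    Matrix.conjTranspose_conjTranspose] at h
  calc shiftOp z * annih k = shiftOp z * (annih k * (shiftOp z)ᴴ) * shiftOp z := by
        rw [mul_assoc, mul_assoc, conjTranspose_mul_shiftOp, mul_one]
    _ = _ := by rw [h, ← mul_assoc, shiftOp_mul_conjTranspose, one_mul]

/-! ### The offset basis -/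

theorem majorana_mulVec_ket (k : Fin L) (x : Bits L) :
    majorana (k, 0) *ᵥ ket x = jwSign k x • ket (flip k x) := by
  funext y
  rw [majorana_mulVec]
  by_cases h : y = flip k x
  · subst h; simp [ket, phase]
  · have h' : flip k y ≠ x := fun h0 => h (by rw [← h0, flip_flip])
    simp [ket, h, h']

theorem offset_prod_mulVec_ket (z x : Bits L) (l : List (Fin L)) (hl : l.Pairwise (· < ·)) :
    (l.reverse.map (fun k => if x k = true then majorana (k, 0) else 1)).prod *ᵥ ket z =
      (l.map (fun k => if x k = true then
        jwSign k (bxor (fun i => x i && decide (i ∈ l)) z) else 1)).prod •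
        ket (bxor (fun k => x k && decide (k ∈ l)) z) := by
  induction l using List.reverseRecOn with
  | nil => simp [show (fun _ : Fin L => false) = zeros L from rfl]
  | append_singleton l a ih =>
    rw [List.pairwise_append] at hl
    have hla : ∀ b ∈ l, b < a := fun b hb => hl.2.2 b hb a (by simp)
    have hal : a ∉ l := fun h => lt_irrefl _ (hla a h)
    have hjw : ∀ k ≤ a, jwSign k (bxor (fun i => x i && decide (i ∈ l ++ [a])) z) =
        jwSign k (bxor (fun i => x i && decide (i ∈ l)) z) := fun k hk =>
      jwSign_congr fun j hj => by simp [bxor, (hj.trans_le hk).ne]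
    rw [List.reverse_append, List.reverse_singleton, List.singleton_append, List.map_cons,
      List.prod_cons, ← Matrix.mulVec_mulVec, ih hl.1, Matrix.mulVec_smul, List.map_append,
      List.prod_append, List.map_singleton, List.prod_singleton, mul_smul, hjw a le_rfl]
    congr 1
    · congr 1
      refine List.map_congr_left fun k hk => ?_
      rw [hjw k (hla k hk).le]
    · cases hx : x a
      · have : (fun k => x k && decide (k ∈ l ++ [a])) = (fun k => x k && decide (k ∈ l)) := by
          funext k
          by_cases h : k = a
          · subst h; simp [hx]
          · simp [h]
        rw [this]; simp
      · have : (fun k => x k && decide (k ∈ l ++ [a])) =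
            flip a (fun k => x k && decide (k ∈ l)) := by
          funext k
          by_cases h : k = a
          · subst h; simp [hx, hal]
          · simp [h, flip_of_ne h]
        simp only [if_true]
        rw [majorana_mulVec_ket, this, flip_bxor]

/-- The sign `(-1)^{w (w - 1) / 2}` of reversing `w` anticommuting factors. -/
def revSign (x : Bits L) : ℂ := (-1) ^ (weight x).choose 2

@[simp] theorem revSign_mul_self (x : Bits L) : revSign x * revSign x = 1 := by
  rw [revSign, ← mul_pow]; simp

@[simp] theorem revSign_zeros : revSign (zeros L) = 1 := by simp [revSign]

theorem revSign_eq_prod (x : Bits L) :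
    revSign x = ∏ k, if x k = true then jwSign k x else 1 := by
  have key : ∀ s : Finset (Fin L),
      ((-1 : ℂ) ^ s.card.choose 2) = ∏ k ∈ s, (-1) ^ (s.filter (· < k)).card := by
    intro s
    induction s using Finset.induction_on_max with
    | empty => simp
    | insert a s ha ih =>
      have has : a ∉ s := fun h => lt_irrefl _ (ha a h)
      rw [Finset.card_insert_of_notMem has, Finset.prod_insert has, Nat.choose_succ_succ,
        pow_add, ih, Nat.choose_one_right]
      congr 1
      · rw [Finset.filter_insert, if_neg (lt_irrefl a), Finset.filter_true_of_mem ha]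
      · refine Finset.prod_congr rfl fun k hk => ?_
        rw [Finset.filter_insert, if_neg (ha k hk).not_gt]
  rw [revSign, weight, key, ← Finset.prod_filter]
  rfl

theorem offsetKet_eq (z x : Bits L) :
    offsetKet z x = (revSign x * refSign z x) • ket (bxor x z) := by
  rw [offsetKet, offset_prod_mulVec_ket z x _ (List.pairwise_lt_finRange L)]
  simp only [List.mem_finRange, decide_true, Bool.and_true]
  congr 1
  rw [revSign_eq_prod, refSign, ← Finset.prod_mul_distrib, ← List.prod_ofFn, List.ofFn_eq_map]
  congr 1
  refine List.map_congr_left fun k _ => ?_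
  split_ifs <;> simp [jwSign_bxor]

theorem offsetKet_eq_shiftOp (z x : Bits L) :
    offsetKet z x = revSign x • (shiftOp z *ᵥ ket x) := by
  rw [offsetKet_eq, shiftOp_mulVec_ket, smul_smul]

theorem offsetTensor_eq (z : Bits L) (ψ : Vec L) (x : Bits L) :
    offsetTensor z ψ x = revSign x * ((shiftOp z)ᴴ *ᵥ ψ) x := by
  have h : star (revSign x) = revSign x := by simp [revSign]
  rw [shiftOp_conjTranspose_mulVec, offsetTensor, offsetKet_eq, ← mul_assoc]
  simp only [braket, star_smul, smul_dotProduct, star_mul, h, star_refSign]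
  change _ • braket (ket _) ψ = _
  rw [braket_ket, smul_eq_mul, mul_comm (refSign z x)]

theorem offsetTensor_zeros (z : Bits L) (ψ : Vec L) : offsetTensor z ψ (zeros L) = ψ z := by
  rw [offsetTensor_eq, shiftOp_conjTranspose_mulVec]; simp

theorem sum_smul_ket (ψ : Vec L) : ∑ x, ψ x • ket x = ψ := by
  funext y
  simp [ket, Finset.sum_apply, Pi.single_apply]

theorem sum_smul_offsetKet (z : Bits L) (T : Tensor L) :
    ∑ x, T x • offsetKet z x = shiftOp z *ᵥ (fun x => revSign x * T x) := by
  conv_rhs => rw [← sum_smul_ket (fun x => revSign x * T x)]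
  rw [Matrix.mulVec_sum]
  refine Finset.sum_congr rfl fun x _ => ?_
  rw [offsetKet_eq_shiftOp, Matrix.mulVec_smul, smul_smul, mul_comm]

theorem sum_offsetTensor_smul (z : Bits L) (ψ : Vec L) :
    ∑ x, offsetTensor z ψ x • offsetKet z x = ψ := by
  rw [sum_smul_offsetKet]
  simp only [offsetTensor_eq, ← mul_assoc, revSign_mul_self, one_mul]
  rw [Matrix.mulVec_mulVec, shiftOp_mul_conjTranspose, Matrix.one_mulVec]

/-! ### Parity -/

/-- The fermion parity operator. -/
def parityOp (L : ℕ) : Op L := Matrix.diagonal fun x => (-1) ^ weight x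

theorem parityOp_mulVec (ψ : Vec L) (y : Bits L) :
    (parityOp L *ᵥ ψ) y = (-1) ^ weight y * ψ y := by
  rw [parityOp, Matrix.mulVec_diagonal]

theorem neg_one_pow_weight (x : Bits L) :
    (-1 : ℂ) ^ weight x = ∏ k, if x k = true then (-1 : ℂ) else 1 := by
  rw [weight, supp, ← Finset.prod_const, Finset.prod_filter]

theorem neg_one_pow_weight_flip (k : Fin L) (x : Bits L) :
    (-1 : ℂ) ^ weight (flip k x) = -(-1) ^ weight x := by
  simp only [neg_one_pow_weight]
  rw [← Finset.mul_prod_erase _ _ (Finset.mem_univ k),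
    ← Finset.mul_prod_erase _ (fun i => if x i = true then _ else _) (Finset.mem_univ k),
    ← neg_mul]
  congr 1
  · cases hx : x k <;> simp [hx]
  · refine Finset.prod_congr rfl fun i hi => ?_
    rw [flip_of_ne (Finset.ne_of_mem_erase hi)]

theorem parityOp_mul_majorana (p : Fin L × Fin 2) :
    parityOp L * majorana p = -(majorana p * parityOp L) := by
  refine op_ext fun ψ y => ?_
  rw [Matrix.neg_mulVec, Pi.neg_apply]
  simp only [← Matrix.mulVec_mulVec, majorana_mulVec, parityOp_mulVec, neg_one_pow_weight_flip]
  ring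

theorem parityOp_mulVec_ket (z : Bits L) :
    parityOp L *ᵥ ket z = ((-1 : ℂ) ^ weight z) • ket z := by
  funext y
  rw [parityOp_mulVec]
  by_cases h : y = z
  · subst h; simp [ket]
  · simp [ket, h]

/-! ### Pfaffians of principal submatrices -/

theorem pfAt_eq_pf (A : Matrix (Fin L) (Fin L) ℂ) {x : Bits L} {n : ℕ} {e : Fin n → Fin L}
    (he : StrictMono e) (hx : ∀ k, x k = true ↔ k ∈ Set.range e) :
    pfAt A x = pf n (A.submatrix e e) := by
  have hs : supp x = Finset.univ.image e := by
    ext k; simp [mem_supp, hx]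
  have hcard : (supp x).card = n := by
    rw [hs, Finset.card_image_of_injective _ he.injective]; simp
  have hu := Finset.orderEmbOfFin_unique hcard (f := e)
    (fun i => by rw [hs]; exact Finset.mem_image_of_mem _ (Finset.mem_univ i)) he
  subst hcard
  rw [pfAt, hu]

theorem exists_strictMono (x : Bits L) :
    ∃ e : Fin (weight x) → Fin L, StrictMono e ∧ ∀ k, x k = true ↔ k ∈ Set.range e :=
  ⟨(supp x).orderEmbOfFin rfl, ((supp x).orderEmbOfFin rfl).strictMono, fun k => by
    rw [← mem_supp, ← Finset.mem_coe, ← Finset.range_orderEmbOfFin (supp x) rfl]; rfl⟩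

theorem pf_neg : ∀ (n : ℕ) (A : Matrix (Fin n) (Fin n) ℂ),
    pf n (-A) = (-1) ^ n.choose 2 * pf n A
  | 0, _ => by simp [pf]
  | 1, _ => by simp [pf]
  | n + 2, A => by
    have h : ((-1 : ℂ) ^ (n + 2).choose 2) = -(-1) ^ n.choose 2 := by
      rw [Nat.choose_succ_succ' (n + 1) 1, Nat.choose_succ_succ' n 1]
      simp only [pow_add, Nat.choose_one_right, pow_one]
      have : ((-1 : ℂ) ^ n) * (-1) ^ n = 1 := by rw [← mul_pow]; simp
      linear_combination (-(-1 : ℂ) ^ n.choose 2) * this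
    simp only [pf]
    rw [h, Finset.mul_sum]
    refine Finset.sum_congr rfl fun j _ => ?_
    rw [Matrix.submatrix_neg, Pi.neg_apply, Pi.neg_apply, pf_neg n]
    simp only [Matrix.neg_apply]
    ring

theorem pfAt_neg (A : Matrix (Fin L) (Fin L) ℂ) (x : Bits L) :
    pfAt (-A) x = revSign x * pfAt A x := by
  rw [pfAt, Matrix.submatrix_neg, Pi.neg_apply, Pi.neg_apply, pf_neg]
  rfl

theorem pf_scale : ∀ (n : ℕ) (A : Matrix (Fin n) (Fin n) ℂ) (d : Fin n → ℂ),
    pf n (Matrix.of fun i j => d i * A i j * d j) = (∏ i, d i) * pf n A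
  | 0, _, _ => by simp [pf]
  | 1, _, _ => by simp [pf]
  | n + 2, A, d => by
    simp only [pf]
    rw [Finset.mul_sum]
    refine Finset.sum_congr rfl fun j _ => ?_
    have := pf_scale n (A.submatrix (fun i => (j.succAbove i).succ) (fun i => (j.succAbove i).succ))
      (fun i => d (j.succAbove i).succ)
    rw [Fin.prod_univ_succ, Fin.prod_univ_succAbove _ j]
    have h2 : ((Matrix.of fun i j => d i * A i j * d j).submatrix
        (fun i => (j.succAbove i).succ) (fun i => (j.succAbove i).succ)) =
        Matrix.of fun i k => d (j.succAbove i).succ * A.submatrix (fun i => (j.succAbove i).succ)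
          (fun i => (j.succAbove i).succ) i k * d (j.succAbove k).succ := rfl
    rw [h2, this, Matrix.of_apply]
    ring

theorem pfAt_scale (A : Matrix (Fin L) (Fin L) ℂ) (d : Fin L → ℂ) (x : Bits L) :
    pfAt (Matrix.of fun i j => d i * A i j * d j) x =
      (∏ k, if x k = true then d k else 1) * pfAt A x := by
  obtain ⟨e, he, hx⟩ := exists_strictMono x
  rw [pfAt_eq_pf _ he hx, pfAt_eq_pf A he hx]
  have h : (∏ k, if x k = true then d k else 1) = ∏ i, d (e i) := by
    rw [← Finset.prod_filter, ← Finset.prod_image (f := d) (g := e) (fun _ _ _ _ h => he.injective h)]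
    refine Finset.prod_congr ?_ fun _ _ => rfl
    ext k; simp [hx]
  rw [h, ← pf_scale]
  rfl

theorem jwSign_strictMono {x : Bits L} {n : ℕ} {e : Fin n → Fin L} (he : StrictMono e)
    (hx : ∀ k, x k = true ↔ k ∈ Set.range e) (i : Fin n) : jwSign (e i) x = (-1) ^ (i : ℕ) := by
  have : (supp x).filter (fun j => j < e i) = (Finset.Iio i).image e := by
    ext k
    simp only [Finset.mem_filter, mem_supp, hx, Set.mem_range, Finset.mem_image, Finset.mem_Iio]
    constructor
    · rintro ⟨⟨j, rfl⟩, h⟩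
      exact ⟨j, he.lt_iff_lt.1 h, rfl⟩
    · rintro ⟨j, h, rfl⟩
      exact ⟨⟨j, rfl⟩, he h⟩
  rw [jwSign, this, Finset.card_image_of_injective _ he.injective, Fin.card_Iio]

theorem flip_strictMono_range {x : Bits L} {n : ℕ} {e : Fin (n + 1) → Fin L} (he : StrictMono e)
    (hx : ∀ k, x k = true ↔ k ∈ Set.range e) (i : Fin (n + 1)) (k : Fin L) :
    flip (e i) x k = true ↔ k ∈ Set.range (e ∘ i.succAbove) := by
  by_cases hk : k = e i
  · subst hk
    have h1 : x (e i) = true := (hx _).2 ⟨i, rfl⟩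
    simp only [flip_same, h1, Bool.not_true, Bool.false_eq_true, false_iff, Set.mem_range,
      Function.comp_apply, not_exists]
    exact fun j hj => Fin.succAbove_ne i j (he.injective hj)
  · rw [flip_of_ne hk, hx]
    constructor
    · rintro ⟨j, rfl⟩
      obtain ⟨m, rfl⟩ := Fin.exists_succAbove_eq (fun h : j = i => hk (by rw [h]))
      exact ⟨m, rfl⟩
    · rintro ⟨m, rfl⟩
      exact ⟨_, rfl⟩

/-- A vector with Grassmann-Gaussian annihilators has Pfaffian amplitudes. -/
theorem apply_eq_pfAt {A : Matrix (Fin L) (Fin L) ℂ} {ψ : Vec L}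
    (h : ∀ j, annih j *ᵥ ψ = ∑ k, A j k • (create k *ᵥ ψ)) (x : Bits L) :
    ψ x = ψ (zeros L) * pfAt A x := by
  have first {x : Bits L} {n : ℕ} {e : Fin (n + 1) → Fin L} (he : StrictMono e)
      (hx : ∀ k, x k = true ↔ k ∈ Set.range e) :
      ψ x = ∑ j : Fin n, A (e 0) (e j.succ) * ((-1) ^ (j : ℕ) *
        ψ (flip (e j.succ) (flip (e 0) x))) := by
    have h1 : x (e 0) = true := (hx _).2 ⟨0, rfl⟩
    have hy := flip_strictMono_range he hx 0
    have hsm : StrictMono (e ∘ (0 : Fin (n + 1)).succAbove) :=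
      he.comp (Fin.strictMono_succAbove 0)
    have h2 := congrFun (h (e 0)) (flip (e 0) x)
    rw [annih_mulVec] at h2
    simp only [flip_same, h1, Bool.not_true, if_true, jwSign_flip_self, flip_flip,
      Finset.sum_apply, Pi.smul_apply, create_mulVec, smul_eq_mul] at h2
    rw [jwSign_strictMono he hx 0, Fin.val_zero, pow_zero, one_mul] at h2
    rw [h2]
    simp only [mul_ite, mul_zero]
    rw [← Finset.sum_filter]
    have himg : Finset.univ.filter (fun k => flip (e 0) x k = true) =
        Finset.univ.image (e ∘ (0 : Fin (n + 1)).succAbove) := by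
      ext k; simp only [Finset.mem_filter, Finset.mem_univ, true_and, hy]; simp
    rw [himg, Finset.sum_image (fun _ _ _ _ h => hsm.injective h)]
    refine Finset.sum_congr rfl fun j _ => ?_
    rw [jwSign_strictMono hsm hy j]
    simp
  obtain ⟨e, he, hx⟩ := exists_strictMono x
  rw [pfAt_eq_pf A he hx]
  generalize weight x = n at e he hx
  induction n using Nat.twoStepInduction generalizing x with
  | zero =>
    have : x = zeros L := by
      funext k
      have := (hx k).not.2 (by simp)
      simpa [zeros] using this
    rw [this, pf, mul_one]
  | one => rw [first he hx]; simp [pf]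
  | more n ih _ =>
    rw [first he hx, pf, Finset.mul_sum]
    refine Finset.sum_congr rfl fun j _ => ?_
    have hy := flip_strictMono_range he hx 0
    have hsm : StrictMono (e ∘ (0 : Fin (n + 2)).succAbove) :=
      he.comp (Fin.strictMono_succAbove 0)
    have hy2 := flip_strictMono_range hsm hy j
    have := ih (flip (e j.succ) (flip (e 0) x)) _ (hsm.comp (Fin.strictMono_succAbove j)) hy2
    rw [this, Matrix.submatrix_submatrix, Matrix.submatrix_apply]
    have hc : (e ∘ (0 : Fin (n + 2)).succAbove) ∘ j.succAbove =
        e ∘ fun i => (j.succAbove i).succ := by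
      funext i; simp
    rw [hc]
    ring

/-! ### Exponentials and commutators -/

section ExpAlgebra

variable {𝔸 : Type*} [NormedRing 𝔸] [NormedAlgebra ℂ 𝔸] [CompleteSpace 𝔸]

/-- A solution of the Heisenberg equation `Y' = [X, Y]` is a conjugation by the exponential. -/
theorem exp_mul_eq_of_hasDerivAt {X : 𝔸} {Y : ℝ → 𝔸}
    (hY : ∀ t, HasDerivAt Y (X * Y t - Y t * X) t) :
    NormedSpace.exp X * Y 0 = Y 1 * NormedSpace.exp X := by
  have hd : ∀ t, HasDerivAt
      (fun t : ℝ => NormedSpace.exp (t • -X) * Y t * NormedSpace.exp (t • X)) 0 t := by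
    intro t
    have := ((hasDerivAt_exp_smul_const (-X) t).mul (hY t)).mul (hasDerivAt_exp_smul_const' X t)
    refine this.congr_deriv ?_
    simp only [Pi.mul_apply]
    noncomm_ring
  have hc := is_const_of_deriv_eq_zero (fun t => (hd t).differentiableAt)
    (fun t => (hd t).deriv) 0 1
  simp only [zero_smul, NormedSpace.exp_zero, one_mul, mul_one, one_smul] at hc
  have h1 : NormedSpace.exp X * NormedSpace.exp (-X) = 1 := by
    let _ : NormedAlgebra ℚ 𝔸 := NormedAlgebra.restrictScalars ℚ ℂ 𝔸
    rw [← NormedSpace.exp_add_of_commute (Commute.neg_right (Commute.refl X)), add_neg_cancel,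
      NormedSpace.exp_zero]
  rw [hc, ← mul_assoc, ← mul_assoc, h1, one_mul]

/-- If `C = [X, F]` commutes with `X`, then `exp X * F = (F + C) * exp X`. -/
theorem exp_mul_of_commutator {X F C : 𝔸} (h : X * F - F * X = C)
    (hC : X * C = C * X) : NormedSpace.exp X * F = (F + C) * NormedSpace.exp X := by
  have := exp_mul_eq_of_hasDerivAt (X := X) (Y := fun t : ℝ => F + t • C) (fun t => by
    have h1 : HasDerivAt (fun t : ℝ => F + t • C) ((1 : ℝ) • C) t :=
      ((hasDerivAt_id t).smul_const C).const_add F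
    refine h1.congr_deriv ?_
    rw [one_smul, mul_add, add_mul, mul_smul_comm, smul_mul_assoc, hC, ← h]
    abel)
  simpa using this

open scoped Matrix.Norms.Operator in
/-- Conjugation by `exp X` acts linearly on a family on which `ad X` acts linearly. -/
theorem exp_mul_of_commutator_family {ι : Type*} [Fintype ι] [DecidableEq ι] {X : 𝔸}
    {F : ι → 𝔸} {M : Matrix ι ι ℂ}
    (h : ∀ r, X * F r - F r * X = ∑ p, M p r • F p) (r : ι) :
    NormedSpace.exp X * F r = (∑ p, NormedSpace.exp M p r • F p) * NormedSpace.exp X := by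
  have := exp_mul_eq_of_hasDerivAt (X := X)
    (Y := fun t : ℝ => ∑ p, NormedSpace.exp (t • M) p r • F p) (fun t => by
    have hM : ∀ p, HasDerivAt (fun t : ℝ => NormedSpace.exp (t • M) p r)
        ((M * NormedSpace.exp (t • M)) p r) t := fun p => by
      have h1 := hasDerivAt_exp_smul_const' M t
      have h2 : HasDerivAt (fun t : ℝ => NormedSpace.exp (t • M) p)
        ((M * NormedSpace.exp (t • M)) p) t := hasDerivAt_pi.1 h1 p
      exact hasDerivAt_pi.1 h2 r
    refine (HasDerivAt.fun_sum fun p _ => (hM p).smul_const (F p)).congr_deriv ?_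
    simp only [Finset.mul_sum, Finset.sum_mul, ← Finset.sum_sub_distrib, mul_smul_comm,
      smul_mul_assoc, ← smul_sub, h, Matrix.mul_apply, Finset.sum_smul, Finset.smul_sum, smul_smul]
    rw [Finset.sum_comm]
    refine Finset.sum_congr rfl fun p _ => Finset.sum_congr rfl fun q _ => ?_
    rw [mul_comm])
  simpa [Matrix.one_apply] using this

end ExpAlgebra

section ExpMatrix

variable {n : Type*} [Fintype n] [DecidableEq n]

theorem exp_neg_mul_exp (X : Matrix n n ℂ) : NormedSpace.exp (-X) * NormedSpace.exp X = 1 := by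
  rw [← Matrix.exp_add_of_commute _ _ (Commute.neg_left (Commute.refl X)), neg_add_cancel,
    NormedSpace.exp_zero]

theorem exp_mul_exp_neg (X : Matrix n n ℂ) : NormedSpace.exp X * NormedSpace.exp (-X) = 1 :=
  mul_eq_one_comm.1 (exp_neg_mul_exp X)

theorem pow_mulVec_of_eigen {X : Matrix n n ℂ} {v : n → ℂ} {c : ℂ} (h : X *ᵥ v = c • v) (k : ℕ) :
    (X ^ k) *ᵥ v = c ^ k • v := by
  induction k with
  | zero => simp
  | succ k ih =>
    rw [pow_succ, ← Matrix.mulVec_mulVec, h, Matrix.mulVec_smul, ih, smul_smul, pow_succ, mul_comm]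

open scoped Matrix.Norms.Operator in
theorem exp_mulVec_of_eigen {X : Matrix n n ℂ} {v : n → ℂ} {c : ℂ} (h : X *ᵥ v = c • v) :
    NormedSpace.exp X *ᵥ v = Complex.exp c • v := by
  have h1 := NormedSpace.exp_series_hasSum_exp' (𝕂 := ℂ) X
  have h2 := NormedSpace.exp_series_hasSum_exp' (𝕂 := ℂ) c
  have h3 := h1.map (Matrix.mulVecBilin ℂ ℂ |>.flip v) (by
    change Continuous fun A : Matrix n n ℂ => A *ᵥ v
    fun_prop)
  have h4 := h2.smul_const v
  rw [← Complex.exp_eq_exp_ℂ] at h4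
  refine h3.unique ?_
  convert h4 using 2 with k
  change ((k.factorial⁻¹ : ℂ) • X ^ k) *ᵥ v = _
  rw [Matrix.smul_mulVec, pow_mulVec_of_eigen h, smul_assoc]

end ExpMatrix

/-! ### Linear combinations of Majorana operators -/

/-- The linear combination `∑ p, v p • majorana p`. -/
def maj : (Fin L × Fin 2 → ℂ) →ₗ[ℂ] Op L := Fintype.linearCombination ℂ majorana

theorem maj_apply (v : Fin L × Fin 2 → ℂ) : maj v = ∑ p, v p • (majorana p : Op L) := rfl

theorem maj_single (p : Fin L × Fin 2) (a : ℂ) : maj (Pi.single p a) = a • (majorana p : Op L) := by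
  simp [maj]

theorem maj_anticomm (u v : Fin L × Fin 2 → ℂ) :
    maj u * maj v + maj v * maj u = (2 * (u ⬝ᵥ v)) • 1 := by
  have h1 (u v : Fin L × Fin 2 → ℂ) : maj u * maj v =
      ∑ p, ∑ q, (u p * v q) • (majorana p * majorana q : Op L) := by
    simp only [maj_apply, Finset.sum_mul, Finset.mul_sum, smul_mul_assoc, mul_smul_comm,
      Finset.smul_sum, smul_smul]
    rw [Finset.sum_comm]
    simp only [mul_comm]
  rw [h1, h1 v u, Finset.sum_comm (f := fun p q => (v p * u q) • _), dotProduct, Finset.mul_sum,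
    Finset.sum_smul, ← Finset.sum_add_distrib]
  refine Finset.sum_congr rfl fun p _ => ?_
  rw [← Finset.sum_add_distrib, Finset.sum_eq_single p]
  · rw [mul_comm (v p), ← smul_add, majorana_anticomm, if_pos rfl,
      show (2 : Op L) = 1 + 1 by norm_num]
    module
  · intro q _ hq
    rw [mul_comm (v q), ← smul_add, majorana_anticomm, if_neg hq.symm, smul_zero]
  · simp

/-- The coefficient vector of `(γ_{k,0} + s i γ_{k,1}) / 2`. -/
noncomputable def modeVec (k : Fin L) (s : ℂ) : Fin L × Fin 2 → ℂ :=
  Pi.single (k, 0) (1 / 2) + Pi.single (k, 1) (s * (Complex.I / 2))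

theorem annih_eq_maj (k : Fin L) : (annih k : Op L) = maj (modeVec k 1) := by
  rw [annih_eq, modeVec, map_add, maj_single, maj_single, one_mul]

theorem create_eq_maj (k : Fin L) : (create k : Op L) = maj (modeVec k (-1)) := by
  rw [create_eq, modeVec, map_add, maj_single, maj_single, neg_one_mul, neg_smul, sub_eq_add_neg]

theorem modeVec_dotProduct (j k : Fin L) (s t : ℂ) :
    modeVec j s ⬝ᵥ modeVec k t = if j = k then (1 - s * t) / 4 else 0 := by
  have h : s * (Complex.I / 2) * (t * (Complex.I / 2)) = -(s * t) / 4 := by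
    linear_combination (s * t / 4) * Complex.I_mul_I
  rw [modeVec, modeVec]
  split_ifs with hjk
  · subst hjk
    simp [h]
    ring
  · simp [hjk]

/-! ### Quadratic exponentials above the vacuum -/

theorem quadratic_commutator {ι : Type*} [Fintype ι] {A : Matrix ι ι ℂ} (hA : Aᵀ = -A)
    {c : ι → Op L} {F : Op L} {t : ι → ℂ} (h : ∀ a, c a * F + F * c a = t a • 1) :
    (∑ a, ∑ b, A a b • (c a * c b)) * F - F * ∑ a, ∑ b, A a b • (c a * c b) =
      (2 : ℂ) • ∑ a, (∑ b, A a b * t b) • c a := by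
  have h1 (a b : ι) : c a * c b * F - F * (c a * c b) = t b • c a - t a • c b := by
    have ha := h a
    have hb := h b
    calc c a * c b * F - F * (c a * c b)
        = c a * (c b * F + F * c b) - (c a * F + F * c a) * c b := by noncomm_ring
      _ = _ := by rw [ha, hb]; simp
  have hA' (a b : ι) : A b a = -A a b := congrFun (congrFun hA a) b
  simp only [Finset.sum_mul, Finset.mul_sum, ← Finset.sum_sub_distrib, smul_mul_assoc,
    mul_smul_comm, ← smul_sub, h1]
  simp only [smul_sub, smul_smul, Finset.sum_sub_distrib, Finset.sum_smul]
  rw [two_smul, sub_eq_add_neg]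
  congr 1
  rw [Finset.sum_comm, ← Finset.sum_neg_distrib]
  refine Finset.sum_congr rfl fun a _ => ?_
  rw [← Finset.sum_neg_distrib]
  refine Finset.sum_congr rfl fun b _ => ?_
  rw [hA' a b, neg_mul, neg_smul, neg_neg]

theorem create_anticomm (j k : Fin L) :
    (create j : Op L) * create k + create k * create j = (0 : ℂ) • 1 := by
  rw [create_eq_maj, create_eq_maj, maj_anticomm, modeVec_dotProduct]
  simp

theorem create_annih_anticomm (j k : Fin L) :
    (create j : Op L) * annih k + annih k * create j = (if j = k then (1 : ℂ) else 0) • 1 := by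
  rw [create_eq_maj, annih_eq_maj, maj_anticomm, modeVec_dotProduct]
  congr 1
  split_ifs <;> norm_num

theorem quadForm_mul_annih_sub {A : Matrix (Fin L) (Fin L) ℂ} (hA : Aᵀ = -A) (j : Fin L) :
    quadForm A create * annih j - annih j * quadForm A create = -∑ k, A j k • create k := by
  have h := quadratic_commutator hA (fun a => create_annih_anticomm a j)
  have hA' (a b : Fin L) : A b a = -A a b := congrFun (congrFun hA a) b
  rw [quadForm, smul_mul_assoc, mul_smul_comm, ← smul_sub, h, smul_smul]
  simp [hA' j, ← Finset.sum_neg_distrib]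

theorem quadForm_mul_create_sub {A : Matrix (Fin L) (Fin L) ℂ} (hA : Aᵀ = -A) (j : Fin L) :
    quadForm A create * create j - create j * quadForm A create = 0 := by
  have h := quadratic_commutator hA (fun a => create_anticomm a j)
  rw [quadForm, smul_mul_assoc, mul_smul_comm, ← smul_sub, h]
  simp

open scoped Matrix.Norms.Operator in
theorem exp_quadForm_mul_create {A : Matrix (Fin L) (Fin L) ℂ} (hA : Aᵀ = -A) (j : Fin L) :
    NormedSpace.exp (quadForm A create) * create j =
      create j * NormedSpace.exp (quadForm A create) := by
  have := exp_mul_of_commutator (quadForm_mul_create_sub hA j) (by simp)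
  rwa [add_zero] at this

open scoped Matrix.Norms.Operator in
theorem exp_quadForm_mul_annih {A : Matrix (Fin L) (Fin L) ℂ} (hA : Aᵀ = -A) (j : Fin L) :
    NormedSpace.exp (quadForm A create) * annih j =
      (annih j - ∑ k, A j k • create k) * NormedSpace.exp (quadForm A create) := by
  rw [sub_eq_add_neg]
  refine exp_mul_of_commutator (quadForm_mul_annih_sub hA j) ?_
  rw [mul_neg, neg_mul, Finset.mul_sum, Finset.sum_mul]
  congr 1
  refine Finset.sum_congr rfl fun k _ => ?_
  rw [mul_smul_comm, smul_mul_assoc, sub_eq_zero.1 (quadForm_mul_create_sub hA k)]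

theorem exp_quadForm_vacuum_annih {A : Matrix (Fin L) (Fin L) ℂ} (hA : Aᵀ = -A) (j : Fin L) :
    annih j *ᵥ (NormedSpace.exp (quadForm A create) *ᵥ ket (zeros L)) =
      ∑ k, A j k • (create k *ᵥ (NormedSpace.exp (quadForm A create) *ᵥ ket (zeros L))) := by
  have h := congrArg (· *ᵥ ket (zeros L)) (exp_quadForm_mul_annih hA j)
  simp only [← Matrix.mulVec_mulVec, annih_vacuum, Matrix.mulVec_zero, Matrix.sub_mulVec,
    Matrix.sum_mulVec, Matrix.smul_mulVec] at h
  exact (sub_eq_zero.1 h.symm)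

theorem exp_quadForm_vacuum_zeros (A : Matrix (Fin L) (Fin L) ℂ) :
    (NormedSpace.exp (quadForm A create) *ᵥ ket (zeros L)) (zeros L) = 1 := by
  have h0 : (quadForm A create)ᴴ *ᵥ ket (zeros L) = (0 : ℂ) • ket (zeros L) := by
    simp only [quadForm, Matrix.conjTranspose_smul, Matrix.conjTranspose_sum,
      Matrix.conjTranspose_mul, create, Matrix.conjTranspose_conjTranspose, Matrix.smul_mulVec,
      Matrix.sum_mulVec, ← Matrix.mulVec_mulVec, annih_vacuum]
    simp
  have h1 := exp_mulVec_of_eigen h0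
  rw [Complex.exp_zero, one_smul, Matrix.exp_conjTranspose] at h1
  have h2 := congrFun h1 (zeros L)
  simp only [ket, Matrix.mulVec_single_one, Matrix.col_apply, Matrix.conjTranspose_apply,
    Pi.single_eq_same] at h2 ⊢
  rw [← star_star (NormedSpace.exp (quadForm A create) (zeros L) (zeros L)), h2, star_one]

theorem exp_quadForm_vacuum_apply {A : Matrix (Fin L) (Fin L) ℂ} (hA : Aᵀ = -A) (x : Bits L) :
    (NormedSpace.exp (quadForm A create) *ᵥ ket (zeros L)) x = pfAt A x := by
  rw [apply_eq_pfAt (exp_quadForm_vacuum_annih hA), exp_quadForm_vacuum_zeros, one_mul]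

theorem pfaffian_iff_exp {A : Matrix (Fin L) (Fin L) ℂ} (hA : Aᵀ = -A) (ψ : Vec L) :
    (∀ x, ψ x = ψ (zeros L) * pfAt A x) ↔
      ψ = ψ (zeros L) • (NormedSpace.exp (quadForm A create) *ᵥ ket (zeros L)) := by
  rw [funext_iff]
  refine forall_congr' fun x => ?_
  rw [Pi.smul_apply, exp_quadForm_vacuum_apply hA, smul_eq_mul]

/-! ### Transport to other references -/

theorem shiftOp_mul_quadForm (A : Matrix (Fin L) (Fin L) ℂ) (z : Bits L) :
    shiftOp z * quadForm A create = quadForm A (createAt z) * shiftOp z := by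
  simp only [quadForm, mul_smul_comm, smul_mul_assoc, Finset.mul_sum, Finset.sum_mul, mul_assoc]
  simp only [← shiftOp_mul_create, ← mul_assoc]

theorem shiftOp_mul_exp (A : Matrix (Fin L) (Fin L) ℂ) (z : Bits L) :
    shiftOp z * NormedSpace.exp (quadForm A create) =
      NormedSpace.exp (quadForm A (createAt z)) * shiftOp z := by
  have hu : IsUnit (shiftOp z) :=
    ⟨⟨shiftOp z, (shiftOp z)ᴴ, shiftOp_mul_conjTranspose z, conjTranspose_mul_shiftOp z⟩, rfl⟩
  have hinv : (shiftOp z)⁻¹ = (shiftOp z)ᴴ := Matrix.inv_eq_right_inv (shiftOp_mul_conjTranspose z)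
  have h := Matrix.exp_conj (shiftOp z) (quadForm A create) hu
  rw [hinv, shiftOp_mul_quadForm, mul_assoc, shiftOp_mul_conjTranspose, mul_one] at h
  rw [h, mul_assoc, conjTranspose_mul_shiftOp, mul_one]

theorem quadForm_neg (A : Matrix (Fin L) (Fin L) ℂ) (c : Fin L → Op L) :
    quadForm (-A) c = -quadForm A c := by
  simp [quadForm]

theorem offsetTensor_pfaffian_iff {A : Matrix (Fin L) (Fin L) ℂ} {z : Bits L} {ψ : Vec L} :
    (∀ x, offsetTensor z ψ x = offsetTensor z ψ (zeros L) * pfAt A x) ↔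
      ∀ x, ((shiftOp z)ᴴ *ᵥ ψ) x = ((shiftOp z)ᴴ *ᵥ ψ) (zeros L) * pfAt (-A) x := by
  refine forall_congr' fun x => ?_
  rw [offsetTensor_eq, offsetTensor_eq, revSign_zeros, one_mul, pfAt_neg]
  have h := revSign_mul_self x
  constructor <;> intro h1
  · linear_combination revSign x * h1 - ((shiftOp z)ᴴ *ᵥ ψ) x * h
  · linear_combination revSign x * h1 + ((shiftOp z)ᴴ *ᵥ ψ) (zeros L) * pfAt A x * h

theorem offset_pfaffian_iff_exp {A : Matrix (Fin L) (Fin L) ℂ} (hA : Aᵀ = -A) (z : Bits L)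
    (ψ : Vec L) :
    (∀ x, offsetTensor z ψ x = offsetTensor z ψ (zeros L) * pfAt A x) ↔
      ψ = ψ z • (NormedSpace.exp (-quadForm A (createAt z)) *ᵥ ket z) := by
  have hz : ((shiftOp z)ᴴ *ᵥ ψ) (zeros L) = ψ z := by simp [shiftOp_conjTranspose_mulVec]
  have hA' : (-A)ᵀ = -(-A) := by rw [Matrix.transpose_neg, hA]
  have hexp : NormedSpace.exp (-quadForm A (createAt z)) *ᵥ ket z =
      shiftOp z *ᵥ (NormedSpace.exp (quadForm (-A) create) *ᵥ ket (zeros L)) := by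
    rw [Matrix.mulVec_mulVec, shiftOp_mul_exp, quadForm_neg, ← Matrix.mulVec_mulVec, shiftOp_vacuum]
  rw [offsetTensor_pfaffian_iff, pfaffian_iff_exp hA', hz, hexp]
  constructor <;> intro h
  · rw [← Matrix.mulVec_smul, ← h, Matrix.mulVec_mulVec, shiftOp_mul_conjTranspose,
      Matrix.one_mulVec]
  · conv_lhs => rw [h]
    rw [Matrix.mulVec_smul, Matrix.mulVec_mulVec, conjTranspose_mul_shiftOp, Matrix.one_mulVec]

/-! ### Exponentials of real antisymmetric matrices -/

section Orthogonal

variable {ι : Type*} [Fintype ι] [DecidableEq ι]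

theorem aeval_map_mulVec_of_eigen {M : Matrix ι ι ℝ} {u : ι → ℂ} {t : ℝ}
    (h : M.map Complex.ofReal *ᵥ u = (t : ℂ) • u) (p : Polynomial ℝ) :
    (Polynomial.aeval M p).map Complex.ofReal *ᵥ u = ((p.eval t : ℝ) : ℂ) • u := by
  change Complex.ofRealHom.mapMatrix M *ᵥ u = _ at h
  change Complex.ofRealHom.mapMatrix (Polynomial.aeval M p) *ᵥ u = _
  induction p using Polynomial.induction_on' with
  | add p q hp hq =>
    rw [map_add, map_add, Matrix.add_mulVec, hp, hq, Polynomial.eval_add, Complex.ofReal_add,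
      add_smul]
  | monomial n a =>
    rw [Polynomial.aeval_monomial, ← Algebra.smul_def, Polynomial.eval_monomial]
    have : Complex.ofRealHom.mapMatrix (a • M ^ n) =
        (a : ℂ) • (Complex.ofRealHom.mapMatrix M) ^ n := by
      rw [← map_pow]; ext i j; simp
    rw [this, Matrix.smul_mulVec, pow_mulVec_of_eigen h, smul_smul]
    push_cast
    rfl

open scoped Matrix.Norms.Operator in
theorem exp_map_ofReal (G : Matrix ι ι ℝ) :
    (NormedSpace.exp G).map Complex.ofReal = NormedSpace.exp (G.map Complex.ofReal) := by
  refine NormedSpace.map_exp (Complex.ofRealHom.mapMatrix (m := ι)) ?_ G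
  exact continuous_id.matrix_map Complex.continuous_ofReal

theorem cexp_two_arctan (κ : ℝ) :
    Complex.exp (2 * Real.arctan κ * Complex.I) * (1 - Complex.I * κ) = 1 + Complex.I * κ := by
  have hc : (Real.cos (Real.arctan κ) : ℂ) ≠ 0 := by
    exact_mod_cast (Real.cos_arctan_pos κ).ne'
  have hk : (Real.cos (Real.arctan κ) : ℂ) * κ = Real.sin (Real.arctan κ) := by
    conv_lhs => rw [← Real.tan_arctan κ, Real.tan_arctan κ]
    have := Real.tan_arctan κ
    rw [Real.tan_eq_sin_div_cos, div_eq_iff (Real.cos_arctan_pos κ).ne'] at this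
    rw [this]; push_cast; rw [mul_comm]
  apply mul_left_cancel₀ hc
  have h1 : Complex.exp (2 * Real.arctan κ * Complex.I) =
      (Real.cos (Real.arctan κ) + Real.sin (Real.arctan κ) * Complex.I) ^ 2 := by
    rw [Complex.ofReal_cos, Complex.ofReal_sin, ← Complex.exp_mul_I, ← Complex.exp_nat_mul]
    push_cast; ring_nf
  have h2 : (Real.cos (Real.arctan κ) : ℂ) ^ 2 + (Real.sin (Real.arctan κ) : ℂ) ^ 2 = 1 := by
    exact_mod_cast Real.cos_sq_add_sin_sq _
  rw [h1]
  generalize (Real.cos (Real.arctan κ) : ℂ) = c at *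
  generalize (Real.sin (Real.arctan κ) : ℂ) = s at *
  have hI := Complex.I_sq
  linear_combination (-(c + s * Complex.I) ^ 2 * Complex.I - Complex.I) * hk +
    (c + s * Complex.I) * h2 - (c + s * Complex.I) * s ^ 2 * hI

theorem transpose_aeval (M : Matrix ι ι ℝ) (p : Polynomial ℝ) :
    (Polynomial.aeval M p)ᵀ = Polynomial.aeval Mᵀ p := by
  induction p using Polynomial.induction_on' with
  | add p q hp hq => simp [hp, hq]
  | monomial n a => simp [Polynomial.aeval_monomial, ← Algebra.smul_def, Matrix.transpose_pow]

theorem matrix_ext_of_eigenvectorBasis {H : Matrix ι ι ℂ} (hH : H.IsHermitian)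
    {A B : Matrix ι ι ℂ}
    (h : ∀ j, A *ᵥ (hH.eigenvectorBasis j).ofLp = B *ᵥ (hH.eigenvectorBasis j).ofLp) : A = B := by
  have hU : A * (hH.eigenvectorUnitary : Matrix ι ι ℂ) = B * hH.eigenvectorUnitary := by
    refine Matrix.ext_of_mulVec_single fun j => ?_
    rw [← Matrix.mulVec_mulVec, ← Matrix.mulVec_mulVec, Matrix.IsHermitian.eigenvectorUnitary_mulVec,
      h]
  have hU1 := Unitary.mul_star_self_of_mem hH.eigenvectorUnitary.2
  calc A = A * hH.eigenvectorUnitary * star (hH.eigenvectorUnitary : Matrix ι ι ℂ) := by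
        rw [mul_assoc, hU1, mul_one]
    _ = B := by rw [hU, mul_assoc, hU1, mul_one]

/-- Inverse Cayley transform as an exponential: for antisymmetric `K` there is an antisymmetric
`G = K * M` with `exp G * (1 + K) = 1 - K`. -/
theorem exists_exp_mul_one_add {K : Matrix ι ι ℝ} (hK : Kᵀ = -K) :
    ∃ M : Matrix ι ι ℝ, Commute K M ∧ (K * M)ᵀ = -(K * M) ∧
      NormedSpace.exp (K * M) * (1 + K) = 1 - K := by
  have hH : (Complex.I • K.map Complex.ofReal).IsHermitian := by
    ext i j
    have : K j i = -K i j := congrFun (congrFun hK i) j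
    simp [Matrix.conjTranspose_apply, this]
  set κ := hH.eigenvalues with hκ
  let r : ℝ → ℝ := fun t => -2 * Real.arctan (√(-t)) / √(-t)
  let s := Lagrange.interpolate (Finset.univ.image fun j => -κ j ^ 2) id r
  have hs (j : ι) : κ j * s.eval (-κ j ^ 2) = -2 * Real.arctan (κ j) := by
    have h1 : s.eval (-κ j ^ 2) = r (-κ j ^ 2) :=
      Lagrange.eval_interpolate_at_node (v := id) r (Set.injOn_id _)
        (Finset.mem_image_of_mem _ (Finset.mem_univ j))
    rw [h1]
    simp only [r, neg_neg, Real.sqrt_sq_eq_abs]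
    rcases eq_or_ne (κ j) 0 with h0 | h0
    · simp [h0]
    · rcases abs_cases (κ j) with ⟨h, _⟩ | ⟨h, _⟩ <;> rw [h]
      · field_simp
      · rw [Real.arctan_neg]; field_simp
  have hcomm : Commute K (Polynomial.aeval (K * K) s) := by
    have h1 : Commute K (K * K) := (Commute.refl K).mul_right (Commute.refl K)
    induction s using Polynomial.induction_on' with
    | add p q hp hq => rw [map_add]; exact hp.add_right hq
    | monomial n a =>
      rw [Polynomial.aeval_monomial, ← Algebra.smul_def]
      exact (h1.pow_right n).smul_right a
  refine ⟨Polynomial.aeval (K * K) s, hcomm, ?_, ?_⟩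
  · rw [Matrix.transpose_mul, transpose_aeval, Matrix.transpose_mul, hK, neg_mul_neg, mul_neg,
      hcomm.eq]
  · apply Matrix.map_injective Complex.ofReal_injective
    change Complex.ofRealHom.mapMatrix _ = Complex.ofRealHom.mapMatrix _
    rw [map_mul, map_add, map_sub, map_one]
    change Matrix.map (NormedSpace.exp _) Complex.ofReal * _ = _
    rw [exp_map_ofReal]
    refine matrix_ext_of_eigenvectorBasis hH fun j => ?_
    have hu := hH.mulVec_eigenvectorBasis j
    rw [← hκ] at hu
    set u := (hH.eigenvectorBasis j).ofLp
    have hKu : K.map Complex.ofReal *ᵥ u = (-(Complex.I * κ j)) • u := by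
      rw [Matrix.smul_mulVec] at hu
      have := congrArg (fun w => -Complex.I • w) hu
      simp only [smul_smul, neg_mul, Complex.I_mul_I, neg_neg, one_smul] at this
      rw [this, ← Complex.coe_smul, smul_smul, neg_mul]
    have hKKu : (K * K).map Complex.ofReal *ᵥ u = ((-κ j ^ 2 : ℝ) : ℂ) • u := by
      change Complex.ofRealHom.mapMatrix (K * K) *ᵥ u = _
      rw [map_mul, ← Matrix.mulVec_mulVec]
      change K.map Complex.ofReal *ᵥ (K.map Complex.ofReal *ᵥ u) = _
      rw [hKu, Matrix.mulVec_smul, hKu, smul_smul]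
      congr 1
      push_cast
      linear_combination (κ j : ℂ) ^ 2 * Complex.I_sq
    have hGu : (K * Polynomial.aeval (K * K) s).map Complex.ofReal *ᵥ u =
        (2 * Real.arctan (κ j) * Complex.I) • u := by
      change Complex.ofRealHom.mapMatrix (K * _) *ᵥ u = _
      rw [map_mul, ← Matrix.mulVec_mulVec]
      change K.map Complex.ofReal *ᵥ ((Polynomial.aeval (K * K) s).map Complex.ofReal *ᵥ u) = _
      rw [aeval_map_mulVec_of_eigen hKKu, Matrix.mulVec_smul, hKu, smul_smul]
      congr 1
      have := congrArg Complex.ofReal (hs j)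
      push_cast at this ⊢
      linear_combination -Complex.I * this
    have hE := exp_mulVec_of_eigen hGu
    rw [← Matrix.mulVec_mulVec, Matrix.add_mulVec, Matrix.sub_mulVec, Matrix.one_mulVec]
    change _ *ᵥ (u + K.map Complex.ofReal *ᵥ u) = u - K.map Complex.ofReal *ᵥ u
    rw [hKu, Matrix.mulVec_add, Matrix.mulVec_smul, hE]
    have := cexp_two_arctan (κ j)
    have h2 := congrArg (fun c : ℂ => c • u) this
    simp only [mul_sub, sub_smul, add_smul, mul_one, one_smul] at h2
    rw [neg_smul, neg_smul, sub_neg_eq_add, ← h2, smul_smul, sub_eq_add_neg,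
      mul_comm (Complex.I * (κ j : ℂ))]

/-- The orthogonal reflection along a unit vector `v`. -/
def refl (v : ι → ℝ) : Matrix ι ι ℝ := 1 - (2 : ℝ) • Matrix.vecMulVec v v

theorem refl_mulVec (v x : ι → ℝ) : refl v *ᵥ x = x - (2 * (v ⬝ᵥ x)) • v := by
  rw [refl, Matrix.sub_mulVec, Matrix.one_mulVec, Matrix.smul_mulVec, Matrix.vecMulVec_mulVec]
  simp [smul_smul]

omit [Fintype ι] in
theorem refl_transpose (v : ι → ℝ) : (refl v)ᵀ = refl v := by
  simp [refl, Matrix.transpose_vecMulVec]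

theorem refl_mul_self {v : ι → ℝ} (hv : v ⬝ᵥ v = 1) : refl v * refl v = 1 := by
  simp [refl, mul_sub, sub_mul, Matrix.vecMulVec_mul_vecMulVec, hv]
  module

/-- An orthogonal matrix without eigenvalue `-1` is the exponential of an antisymmetric matrix. -/
theorem exists_exp_eq_of_isUnit {R : Matrix ι ι ℝ} (hR : Rᵀ * R = 1) (hu : IsUnit (1 + R)) :
    ∃ G : Matrix ι ι ℝ, Gᵀ = -G ∧ (∀ x, R *ᵥ x = x → G *ᵥ x = 0) ∧ NormedSpace.exp G = R := by
  obtain ⟨⟨S, C, hSC, hCS⟩, hS⟩ := hu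
  simp only at hS
  subst hS
  have hRS : (1 - R) * (1 + R) = (1 + R) * (1 - R) := by noncomm_ring
  have hRR : R * Rᵀ = 1 := mul_eq_one_comm.1 hR
  have hK1 : (1 + R) * ((1 - R) * C) = 1 - R := by
    rw [← mul_assoc, ← hRS, mul_assoc, hSC, mul_one]
  have hK2 : (1 - R) * C * (1 + R) = 1 - R := by rw [mul_assoc, hCS, mul_one]
  have hK3 : (1 - R) * C = C * (1 - R) := by
    calc (1 - R) * C = C * (1 + R) * ((1 - R) * C) := by rw [hCS, one_mul]
      _ = C * (1 - R) := by rw [mul_assoc, hK1]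
  set K := (1 - R) * C with hKdef
  have hKT : Kᵀ = -K := by
    have h1 : (1 + Rᵀ) * Kᵀ = 1 - Rᵀ := by
      have := congrArg Matrix.transpose hK2
      simpa [Matrix.transpose_mul] using this
    have h2 : (1 + R) * Kᵀ = -((1 + R) * K) := by
      have h3 : (1 + R) = R * (1 + Rᵀ) := by rw [mul_add, hRR, mul_one, add_comm]
      rw [hK1]
      conv_lhs => rw [h3, mul_assoc, h1, mul_sub, hRR, mul_one]
      abel
    calc Kᵀ = C * ((1 + R) * Kᵀ) := by rw [← mul_assoc, hCS, one_mul]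
      _ = -K := by rw [h2, mul_neg, ← mul_assoc, hCS, one_mul]
  obtain ⟨M, hcomm, hT, hE⟩ := exists_exp_mul_one_add hKT
  refine ⟨K * M, hT, fun x hx => ?_, ?_⟩
  · have : (1 - R) *ᵥ x = 0 := by rw [Matrix.sub_mulVec, hx, Matrix.one_mulVec, sub_self]
    rw [hcomm.eq, hK3, ← Matrix.mulVec_mulVec, ← Matrix.mulVec_mulVec, this]
    simp
  · have h1 : (1 + K) * (1 + R) = (2 : ℝ) • 1 := by
      rw [add_mul, hK2, one_mul, two_smul]; abel
    have h2 : (1 - K) * (1 + R) = (2 : ℝ) • R := by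
      rw [sub_mul, hK2, one_mul, two_smul]; abel
    have h3 := congrArg (· * (1 + R)) hE
    simp only [mul_assoc, h1, h2, mul_smul_comm, mul_one] at h3
    exact smul_right_injective _ (two_ne_zero : (2 : ℝ) ≠ 0) h3

open scoped Matrix.Norms.Operator in
theorem exp_smul_of_sq_eq_neg {J P : Matrix ι ι ℝ} (hJJ : J * J = -P) (hJP : J * P = J) (t : ℝ) :
    NormedSpace.exp (t • J) = 1 - P + Real.cos t • P + Real.sin t • J := by
  let E : ℝ → Matrix ι ι ℝ := fun t => 1 - P + Real.cos t • P + Real.sin t • J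
  have hE (t : ℝ) : HasDerivAt E (J * E t) t := by
    have h1 : HasDerivAt E (-Real.sin t • P + Real.cos t • J) t :=
      (((Real.hasDerivAt_cos t).smul_const P).const_add (1 - P)).add
        ((Real.hasDerivAt_sin t).smul_const J)
    refine h1.congr_deriv ?_
    simp only [E, mul_add, mul_sub, mul_one, mul_smul_comm, hJP, hJJ]
    module
  have hd (t : ℝ) : HasDerivAt (fun t : ℝ => NormedSpace.exp (t • -J) * E t) 0 t := by
    refine ((hasDerivAt_exp_smul_const (-J) t).mul (hE t)).congr_deriv ?_
    noncomm_ring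
  have hc := is_const_of_deriv_eq_zero (fun t => (hd t).differentiableAt)
    (fun t => (hd t).deriv) t 0
  have h0 : E 0 = 1 := by simp [E]
  rw [zero_smul, NormedSpace.exp_zero, h0, one_mul] at hc
  have h1 : NormedSpace.exp (t • J) * NormedSpace.exp (t • -J) = 1 := by
    rw [smul_neg, ← Matrix.exp_add_of_commute _ _ (Commute.neg_right (Commute.refl (t • J))),
      add_neg_cancel, NormedSpace.exp_zero]
  calc NormedSpace.exp (t • J) = NormedSpace.exp (t • J) * (NormedSpace.exp (t • -J) * E t) := by
        rw [hc, mul_one]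
    _ = E t := by rw [← mul_assoc, h1, one_mul]

theorem exp_pi_smul_rotation {v e : ι → ℝ} (hv : v ⬝ᵥ v = 1) (he : e ⬝ᵥ e = 1)
    (hve : v ⬝ᵥ e = 0) :
    NormedSpace.exp (Real.pi • (Matrix.vecMulVec v e - Matrix.vecMulVec e v)) =
      refl v * refl e := by
  have hev : e ⬝ᵥ v = 0 := by rw [dotProduct_comm, hve]
  rw [exp_smul_of_sq_eq_neg (P := Matrix.vecMulVec v v + Matrix.vecMulVec e e)]
  · simp [refl, mul_sub, sub_mul, Matrix.vecMulVec_mul_vecMulVec, hve]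
    module
  · simp [mul_sub, sub_mul, Matrix.vecMulVec_mul_vecMulVec, hve, hev, hv, he]
    abel
  · simp [mul_add, sub_mul, Matrix.vecMulVec_mul_vecMulVec, hve, hev, hv, he]
    abel

theorem exists_unit_eigenvector_neg_one {R : Matrix ι ι ℝ} (hu : ¬IsUnit (1 + R)) :
    ∃ e : ι → ℝ, e ⬝ᵥ e = 1 ∧ R *ᵥ e = -e := by
  rw [Matrix.isUnit_iff_isUnit_det, isUnit_iff_ne_zero, not_not] at hu
  obtain ⟨x, hx0, hx⟩ := Matrix.exists_mulVec_eq_zero_iff.2 hu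
  have hpos : 0 < x ⬝ᵥ x :=
    lt_of_le_of_ne (Finset.sum_nonneg fun i _ => mul_self_nonneg _)
      (Ne.symm (mt dotProduct_self_eq_zero.1 hx0))
  have hRx : R *ᵥ x = -x := by
    rw [Matrix.add_mulVec, Matrix.one_mulVec] at hx
    exact (neg_eq_of_add_eq_zero_right hx).symm
  refine ⟨(√(x ⬝ᵥ x))⁻¹ • x, ?_, ?_⟩
  · rw [smul_dotProduct, dotProduct_smul, smul_smul, ← mul_inv, Real.mul_self_sqrt hpos.le,
      smul_eq_mul, inv_mul_cancel₀ hpos.ne']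
  · rw [Matrix.mulVec_smul, hRx, smul_neg]

theorem dotProduct_mulVec_mulVec {R : Matrix ι ι ℝ} (hR : Rᵀ * R = 1) (x y : ι → ℝ) :
    (R *ᵥ x) ⬝ᵥ (R *ᵥ y) = x ⬝ᵥ y := by
  rw [Matrix.dotProduct_mulVec, ← Matrix.mulVec_transpose, Matrix.mulVec_mulVec, hR,
    Matrix.one_mulVec]

/-- A real orthogonal matrix is the exponential of an antisymmetric matrix, possibly times one
reflection. -/
theorem exists_exp_or_exp_mul_refl {R : Matrix ι ι ℝ} (hR : Rᵀ * R = 1) :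
    ∃ G : Matrix ι ι ℝ, Gᵀ = -G ∧ (∀ x, R *ᵥ x = x → G *ᵥ x = 0) ∧
      (NormedSpace.exp G = R ∨ ∃ v, v ⬝ᵥ v = 1 ∧ G *ᵥ v = 0 ∧
        (∀ x, R *ᵥ x = x → v ⬝ᵥ x = 0) ∧ NormedSpace.exp G * refl v = R) := by
  induction hn : Module.finrank ℝ (LinearMap.ker (1 + R).mulVecLin) using Nat.strong_induction_on
    generalizing R with
  | _ n ih =>
  by_cases hu : IsUnit (1 + R)
  · obtain ⟨G, h1, h2, h3⟩ := exists_exp_eq_of_isUnit hR hu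
    exact ⟨G, h1, h2, Or.inl h3⟩
  obtain ⟨e, he, hRe⟩ := exists_unit_eigenvector_neg_one hu
  have hR1 : (R * refl e)ᵀ * (R * refl e) = 1 := by
    rw [Matrix.transpose_mul, refl_transpose, mul_assoc, ← mul_assoc Rᵀ, hR, one_mul,
      refl_mul_self he]
  have hR1e : (R * refl e) *ᵥ e = e := by
    rw [← Matrix.mulVec_mulVec, refl_mulVec, he, Matrix.mulVec_sub, Matrix.mulVec_smul, hRe]
    module
  have hR1x {x : ι → ℝ} (hx : e ⬝ᵥ x = 0) : (R * refl e) *ᵥ x = R *ᵥ x := by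
    rw [← Matrix.mulVec_mulVec, refl_mulVec, hx]
    simp
  have hfix {x : ι → ℝ} (hx : R *ᵥ x = x) : e ⬝ᵥ x = 0 := by
    have := dotProduct_mulVec_mulVec hR e x
    rw [hRe, hx, neg_dotProduct] at this
    linarith
  have hlt : Module.finrank ℝ (LinearMap.ker (1 + R * refl e).mulVecLin) < n := by
    rw [← hn]
    refine Submodule.finrank_lt_finrank_of_lt (lt_of_le_of_ne ?_ ?_)
    · intro x hx
      rw [LinearMap.mem_ker, Matrix.mulVecLin_apply, Matrix.add_mulVec, Matrix.one_mulVec] at hx ⊢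
      have hx' : (R * refl e) *ᵥ x = -x := (neg_eq_of_add_eq_zero_right hx).symm
      have := dotProduct_mulVec_mulVec hR1 e x
      rw [hR1e, hx', dotProduct_neg] at this
      rw [← hR1x (by linarith), hx]
    · intro heq
      have h1 : e ∈ LinearMap.ker (1 + R).mulVecLin := by
        rw [LinearMap.mem_ker, Matrix.mulVecLin_apply, Matrix.add_mulVec, Matrix.one_mulVec, hRe,
          add_neg_cancel]
      rw [← heq, LinearMap.mem_ker, Matrix.mulVecLin_apply, Matrix.add_mulVec, Matrix.one_mulVec,
        hR1e] at h1
      have h2 : e = 0 := by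
        have : (2 : ℝ) • e = 0 := by rw [two_smul, h1]
        simpa using this
      rw [h2] at he
      simp at he
  have hRrefl : R * refl e * refl e = R := by rw [mul_assoc, refl_mul_self he, mul_one]
  obtain ⟨G, hG, hGfix, hG1 | ⟨v, hv, hGv, hvfix, hG1⟩⟩ := ih _ hlt hR1 rfl
  · refine ⟨G, hG, fun x hx => hGfix x (by rw [hR1x (hfix hx), hx]), Or.inr
      ⟨e, he, hGfix e hR1e, fun x hx => hfix hx, ?_⟩⟩
    rw [hG1, hRrefl]
  · have hve := hvfix e hR1e
    have hGe := hGfix e hR1e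
    set J := Matrix.vecMulVec v e - Matrix.vecMulVec e v with hJ
    have hJT : Jᵀ = -J := by
      rw [hJ, Matrix.transpose_sub, Matrix.transpose_vecMulVec, Matrix.transpose_vecMulVec, neg_sub]
    have hGJ : G * J = 0 := by
      rw [hJ, mul_sub, Matrix.mul_vecMulVec, Matrix.mul_vecMulVec, hGv, hGe]
      simp
    have hJG : J * G = 0 := by
      have := congrArg Matrix.transpose hGJ
      rwa [Matrix.transpose_mul, hG, hJT, neg_mul_neg, Matrix.transpose_zero] at this
    have hcomm : Commute G (Real.pi • J) := by
      rw [Commute, SemiconjBy, mul_smul_comm, smul_mul_assoc, hGJ, hJG]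
    refine ⟨G + Real.pi • J, ?_, fun x hx => ?_, Or.inl ?_⟩
    · rw [Matrix.transpose_add, Matrix.transpose_smul, hG, hJT, smul_neg, neg_add]
    · have hx1 : (R * refl e) *ᵥ x = x := by rw [hR1x (hfix hx), hx]
      rw [Matrix.add_mulVec, hGfix x hx1, Matrix.smul_mulVec, hJ, Matrix.sub_mulVec,
        Matrix.vecMulVec_mulVec, Matrix.vecMulVec_mulVec, hfix hx, hvfix x hx1]
      simp
    · rw [Matrix.exp_add_of_commute _ _ hcomm, exp_pi_smul_rotation hv he hve, ← mul_assoc, hG1,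
        hRrefl]

end Orthogonal

/-! ### Pure Gaussian vectors through their annihilators -/

theorem smul_one_mulVec (c : ℂ) (ψ : Vec L) : ((c • (1 : Op L)) *ᵥ ψ) = c • ψ := by
  rw [Matrix.smul_mulVec, Matrix.one_mulVec]

theorem smul_one_op_eq_zero {c : ℂ} (h : c • (1 : Op L) = 0) : c = 0 := by
  have := congrFun (congrFun h (zeros L)) (zeros L)
  simpa using this

theorem maj_injective : Function.Injective (maj (L := L)) := by
  refine (injective_iff_map_eq_zero _).2 fun v hv => ?_
  funext p
  have h := maj_anticomm (Pi.single p 1) v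
  rw [hv, mul_zero, zero_mul, add_zero] at h
  simpa using smul_one_op_eq_zero h.symm

/-- The coefficient vectors of the linear combinations of Majorana operators that annihilate `ψ`. -/
def annihilators (ψ : Vec L) : Submodule ℂ (Fin L × Fin 2 → ℂ) where
  carrier := {v | maj v *ᵥ ψ = 0}
  zero_mem' := by simp
  add_mem' {u v} hu hv := by
    simp only [Set.mem_ofPred_eq] at hu hv ⊢
    rw [map_add, Matrix.add_mulVec, hu, hv, add_zero]
  smul_mem' c v hv := by
    simp only [Set.mem_ofPred_eq] at hv ⊢
    rw [map_smul, Matrix.smul_mulVec, hv, smul_zero]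

theorem mem_annihilators {ψ : Vec L} {v : Fin L × Fin 2 → ℂ} :
    v ∈ annihilators ψ ↔ maj v *ᵥ ψ = 0 := Iff.rfl

/-- A nonzero vector that is annihilated by an `L`-dimensional space of linear combinations of
Majorana operators. -/
def IsPure (ψ : Vec L) : Prop := ψ ≠ 0 ∧ L ≤ Module.finrank ℂ (annihilators ψ)

theorem isPure_vacuum : IsPure (ket (zeros L)) := by
  refine ⟨by simp [ket], ?_⟩
  let b : Fin L → annihilators (ket (zeros L)) := fun k => ⟨modeVec k 1, by
    rw [mem_annihilators, ← annih_eq_maj, annih_vacuum]⟩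
  have hb : LinearIndependent ℂ b := by
    refine LinearIndependent.of_comp (annihilators (ket (zeros L))).subtype ?_
    rw [Fintype.linearIndependent_iff]
    intro g hg j
    have := congrArg (modeVec j (-1) ⬝ᵥ ·) hg
    simp only [dotProduct_sum, dotProduct_smul, b, Function.comp_apply, Submodule.subtype_apply,
      modeVec_dotProduct] at this
    simpa using this
  simpa using hb.fintype_card_le_finrank

/-- Invertible operators that normalize the span of the Majorana operators preserve purity. -/
theorem IsPure.mulVec {ψ : Vec L} (hψ : IsPure ψ) {U V : Op L} (hVU : V * U = 1)
    (hU : ∀ p, ∃ w, U * majorana p = maj w * U) : IsPure (U *ᵥ ψ) := by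
  choose R hR using hU
  have hlin (v : Fin L × Fin 2 → ℂ) :
      U * maj v = maj (Fintype.linearCombination ℂ R v) * U := by
    rw [Fintype.linearCombination_apply, map_sum, maj_apply, Finset.mul_sum, Finset.sum_mul]
    refine Finset.sum_congr rfl fun p _ => ?_
    rw [map_smul, mul_smul_comm, smul_mul_assoc, hR]
  refine ⟨fun h => hψ.1 ?_, hψ.2.trans ?_⟩
  · rw [← Matrix.one_mulVec ψ, ← hVU, ← Matrix.mulVec_mulVec, h, Matrix.mulVec_zero]
  · let f : annihilators ψ →ₗ[ℂ] annihilators (U *ᵥ ψ) :=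
      (Fintype.linearCombination ℂ R).restrict fun v hv => by
        rw [mem_annihilators] at hv ⊢
        rw [Matrix.mulVec_mulVec, ← hlin, ← Matrix.mulVec_mulVec, hv, Matrix.mulVec_zero]
    refine LinearMap.finrank_le_finrank_of_injective (f := f) ?_
    refine (injective_iff_map_eq_zero _).2 fun v hv => ?_
    have h1 : Fintype.linearCombination ℂ R v.1 = 0 := congrArg Subtype.val hv
    have h2 := hlin v.1
    rw [h1, map_zero, zero_mul] at h2
    have h3 : maj v.1 = 0 := by
      rw [← one_mul (maj v.1), ← hVU, mul_assoc, h2, mul_zero]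
    exact Subtype.ext (maj_injective (by rw [h3]; exact (map_zero maj).symm))

theorem exists_majorana_of_annih_create {U : Op L}
    (ha : ∀ k, ∃ w, U * annih k = maj w * U) (hc : ∀ k, ∃ w, U * create k = maj w * U)
    (p : Fin L × Fin 2) : ∃ w, U * majorana p = maj w * U := by
  obtain ⟨k, a⟩ := p
  obtain ⟨u, hu⟩ := ha k
  obtain ⟨v, hv⟩ := hc k
  fin_cases a
  · refine ⟨u + v, ?_⟩
    change U * majorana (k, 0) = _
    rw [majorana_zero, mul_add, hu, hv, map_add, add_mul]
  · refine ⟨(-Complex.I) • (u - v), ?_⟩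
    change U * majorana (k, 1) = _
    rw [majorana_one, mul_smul_comm, mul_sub, hu, hv, map_smul, map_sub, smul_mul_assoc, sub_mul]

theorem createAt_eq_maj (z : Bits L) (k : Fin L) :
    createAt z k = maj (modeVec k (if z k = true then 1 else -1)) := by
  unfold createAt
  split_ifs
  · exact annih_eq_maj k
  · exact create_eq_maj k

theorem createAt_conjTranspose_eq_maj (z : Bits L) (k : Fin L) :
    (createAt z k)ᴴ = maj (modeVec k (if z k = true then -1 else 1)) := by
  unfold createAt
  split_ifs
  · exact create_eq_maj k
  · rw [create, Matrix.conjTranspose_conjTranspose]; exact annih_eq_maj k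

theorem IsPure.shiftOp_mulVec {ψ : Vec L} (hψ : IsPure ψ) (z : Bits L) :
    IsPure (shiftOp z *ᵥ ψ) :=
  hψ.mulVec (conjTranspose_mul_shiftOp z) (exists_majorana_of_annih_create
    (fun k => ⟨_, by rw [shiftOp_mul_annih, createAt_conjTranspose_eq_maj]⟩)
    (fun k => ⟨_, by rw [shiftOp_mul_create, createAt_eq_maj]⟩))

theorem conjTranspose_shiftOp_mul {z : Bits L} {A B : Op L} (h : shiftOp z * A = B * shiftOp z) :
    (shiftOp z)ᴴ * B = A * (shiftOp z)ᴴ := by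
  calc (shiftOp z)ᴴ * B = (shiftOp z)ᴴ * (B * shiftOp z) * (shiftOp z)ᴴ := by
        rw [mul_assoc, mul_assoc, shiftOp_mul_conjTranspose, mul_one]
    _ = A * (shiftOp z)ᴴ := by
        rw [← h, ← mul_assoc, conjTranspose_mul_shiftOp, one_mul]

theorem IsPure.conjTranspose_shiftOp_mulVec {ψ : Vec L} (hψ : IsPure ψ) (z : Bits L) :
    IsPure ((shiftOp z)ᴴ *ᵥ ψ) := by
  have hc (k : Fin L) := conjTranspose_shiftOp_mul (shiftOp_mul_create z k)
  have ha (k : Fin L) := conjTranspose_shiftOp_mul (shiftOp_mul_annih z k)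
  refine hψ.mulVec (shiftOp_mul_conjTranspose z) (exists_majorana_of_annih_create
    (fun k => ?_) (fun k => ?_)) <;> specialize hc k <;> specialize ha k <;>
    unfold createAt at hc ha <;> split_ifs at hc ha
  · exact ⟨_, by rw [hc, create_eq_maj]⟩
  · rw [create, Matrix.conjTranspose_conjTranspose] at ha
    exact ⟨_, by rw [ha, annih_eq_maj]⟩
  · exact ⟨_, by rw [create, ha, annih_eq_maj]⟩
  · exact ⟨_, by rw [hc, create_eq_maj]⟩

theorem isPure_exp_quadForm {A : Matrix (Fin L) (Fin L) ℂ} (hA : Aᵀ = -A) :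
    IsPure (NormedSpace.exp (quadForm A create) *ᵥ ket (zeros L)) :=
  isPure_vacuum.mulVec (exp_neg_mul_exp _) (exists_majorana_of_annih_create
    (fun k => ⟨modeVec k 1 - ∑ j, A k j • modeVec j (-1), by
      rw [exp_quadForm_mul_annih hA, map_sub, map_sum, annih_eq_maj]
      simp only [map_smul, create_eq_maj]⟩)
    (fun k => ⟨_, by rw [exp_quadForm_mul_create hA, create_eq_maj]⟩))

/-- A pure vector overlapping the vacuum has Grassmann-Gaussian annihilators. -/
theorem IsPure.exists_antisymm {ψ : Vec L} (hψ : IsPure ψ) (h0 : ψ (zeros L) ≠ 0) :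
    ∃ A : Matrix (Fin L) (Fin L) ℂ, Aᵀ = -A ∧
      ∀ j, annih j *ᵥ ψ = ∑ k, A j k • (create k *ᵥ ψ) := by
  have hmaj (v : Fin L × Fin 2 → ℂ) : maj v = ∑ k, ((v (k, 0) - Complex.I * v (k, 1)) • annih k +
      (v (k, 0) + Complex.I * v (k, 1)) • (create k : Op L)) := by
    rw [maj_apply, Fintype.sum_prod_type]
    refine Finset.sum_congr rfl fun k _ => ?_
    rw [Fin.sum_univ_two, majorana_zero, majorana_one]
    module
  let a : (Fin L × Fin 2 → ℂ) →ₗ[ℂ] (Fin L → ℂ) := LinearMap.pi fun k =>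
    LinearMap.proj (k, 0) - Complex.I • LinearMap.proj (k, 1)
  have ha (v : Fin L × Fin 2 → ℂ) (k : Fin L) : a v k = v (k, 0) - Complex.I * v (k, 1) := rfl
  have hinj : Function.Injective (a.domRestrict (annihilators ψ)) := by
    refine (injective_iff_map_eq_zero _).2 fun ⟨v, hv⟩ hav => ?_
    have hav' (k : Fin L) : v (k, 0) - Complex.I * v (k, 1) = 0 := congrFun hav k
    have hb (k : Fin L) : v (k, 0) + Complex.I * v (k, 1) = 0 := by
      rw [mem_annihilators, hmaj] at hv
      have := congrFun hv (flip k (zeros L))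
      simp only [hav', zero_smul, zero_add, Matrix.sum_mulVec, Matrix.smul_mulVec,
        Finset.sum_apply, Pi.smul_apply, create_mulVec] at this
      rw [Finset.sum_eq_single k] at this
      · simpa [zeros, h0] using this
      · intro j _ hj
        rw [flip_of_ne hj]; simp [zeros]
      · simp
    refine Subtype.ext (funext fun ⟨k, i⟩ => ?_)
    fin_cases i
    · change v (k, 0) = 0
      linear_combination (1 / 2 : ℂ) * hav' k + (1 / 2 : ℂ) * hb k
    · change v (k, 1) = 0
      linear_combination (Complex.I / 2) * hav' k - (Complex.I / 2) * hb k +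
        v (k, 1) * Complex.I_mul_I
  have hrank : Module.finrank ℂ (annihilators ψ) = Module.finrank ℂ (Fin L → ℂ) :=
    le_antisymm (LinearMap.finrank_le_finrank_of_injective hinj) (by simpa using hψ.2)
  have hsurj := (LinearMap.injective_iff_surjective_of_finrank_eq_finrank hrank).1 hinj
  choose v hv using fun j => hsurj (Pi.single j 1)
  have hv0 (j k : Fin L) : (v j).1 (k, 0) - Complex.I * (v j).1 (k, 1) =
      (Pi.single j 1 : Fin L → ℂ) k := congrFun (hv j) k
  let b : Matrix (Fin L) (Fin L) ℂ :=
    Matrix.of fun j k => (v j).1 (k, 0) + Complex.I * (v j).1 (k, 1)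
  refine ⟨-b, ?_, fun j => ?_⟩
  · ext i j
    have h1 := maj_anticomm (v i).1 (v j).1
    have h2 := congrArg (· *ᵥ ψ) h1
    simp only [Matrix.add_mulVec, ← Matrix.mulVec_mulVec, mem_annihilators.1 (v i).2,
      mem_annihilators.1 (v j).2, Matrix.mulVec_zero, add_zero, smul_one_mulVec] at h2
    have h3 := (smul_eq_zero.1 h2.symm).resolve_right hψ.1
    have h4 : 2 * ((v i).1 ⬝ᵥ (v j).1) = b i j + b j i := by
      have h5 : 2 * ((v i).1 ⬝ᵥ (v j).1) =
          ∑ k, ((Pi.single i 1 : Fin L → ℂ) k * b j k + b i k * (Pi.single j 1 : Fin L → ℂ) k) := by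
        rw [dotProduct, Fintype.sum_prod_type, Finset.mul_sum]
        refine Finset.sum_congr rfl fun k _ => ?_
        rw [Fin.sum_univ_two, ← hv0, ← hv0]
        simp only [b, Matrix.of_apply]
        linear_combination (2 * (v i).1 (k, 1) * (v j).1 (k, 1)) * Complex.I_mul_I
      rw [h5, Finset.sum_add_distrib]
      simp [Pi.single_apply, add_comm]
    rw [h3] at h4
    simp only [Matrix.transpose_apply, Matrix.neg_apply, neg_neg]
    linear_combination h4
  · have h1 := mem_annihilators.1 (v j).2
    rw [hmaj] at h1
    simp only [hv0, Matrix.sum_mulVec, Matrix.add_mulVec, Matrix.smul_mulVec,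
      Finset.sum_add_distrib] at h1
    rw [Finset.sum_eq_single j (by intro k _ hk; simp [hk]) (by simp), Pi.single_eq_same,
      one_smul] at h1
    rw [eq_neg_of_add_eq_zero_left h1, ← Finset.sum_neg_distrib]
    simp only [b, Matrix.neg_apply, Matrix.of_apply, neg_smul]

/-! ### Gaussian unitaries -/

theorem gaussianUnitary_mul_maj {G : Matrix (Fin L × Fin 2) (Fin L × Fin 2) ℝ} (hG : Gᵀ = -G)
    (v : Fin L × Fin 2 → ℂ) :
    gaussianUnitary G * maj v =
      maj ((NormedSpace.exp G).map Complex.ofReal *ᵥ v) * gaussianUnitary G := by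
  have hGc : (G.map Complex.ofReal)ᵀ = -G.map Complex.ofReal := by
    ext i j
    have : G j i = -G i j := congrFun (congrFun hG i) j
    simp [this]
  have hfam (r : Fin L × Fin 2) :
      ((-Complex.I) • quadHam G) * majorana r - majorana r * ((-Complex.I) • quadHam G) =
        ∑ p, (G.map Complex.ofReal) p r • (majorana p : Op L) := by
    have h := quadratic_commutator hGc (F := (majorana r : Op L))
      (t := fun a => if a = r then (2 : ℂ) else 0) (c := majorana) (fun a => by
        rw [majorana_anticomm]
        split_ifs
        · rw [show (2 : Op L) = 1 + 1 by norm_num]; module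
        · simp)
    have hI : -Complex.I * (Complex.I / 4) = 1 / 4 := by
      linear_combination (-1 / 4 : ℂ) * Complex.I_mul_I
    rw [quadHam, smul_smul, hI, smul_mul_assoc, mul_smul_comm, ← smul_sub]
    simp only [Matrix.map_apply] at h ⊢
    rw [h, smul_smul, Finset.smul_sum]
    refine Finset.sum_congr rfl fun a _ => ?_
    rw [smul_smul]
    congr 1
    simp
    ring
  have hexp (r : Fin L × Fin 2) : gaussianUnitary G * majorana r =
      (∑ p, NormedSpace.exp (G.map Complex.ofReal) p r • majorana p) * gaussianUnitary G := by
    open scoped Matrix.Norms.Operator in exact exp_mul_of_commutator_family hfam r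
  rw [exp_map_ofReal, maj_apply, maj_apply, Finset.mul_sum]
  simp only [mul_smul_comm, hexp, Matrix.mulVec, dotProduct, Finset.sum_smul, Finset.sum_mul,
    smul_mul_assoc, Finset.smul_sum, smul_smul]
  rw [Finset.sum_comm]
  simp only [mul_comm]

theorem exists_gaussianUnitary_inv (G : Matrix (Fin L × Fin 2) (Fin L × Fin 2) ℝ) :
    ∃ V : Op L, V * gaussianUnitary G = 1 ∧ gaussianUnitary G * V = 1 :=
  ⟨_, exp_neg_mul_exp _, exp_mul_exp_neg _⟩

theorem parityOp_commute_gaussianUnitary (G : Matrix (Fin L × Fin 2) (Fin L × Fin 2) ℝ) :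
    Commute (parityOp L) (gaussianUnitary G) := by
  refine Commute.exp_right (Commute.smul_right ?_ _)
  refine Commute.smul_right (Commute.sum_right _ _ _ fun p _ => Commute.sum_right _ _ _ fun q _ =>
    Commute.smul_right ?_ _) _
  rw [Commute, SemiconjBy, ← mul_assoc, parityOp_mul_majorana, neg_mul, mul_assoc,
    parityOp_mul_majorana, mul_neg, neg_neg, mul_assoc]

theorem parityOp_mul_maj (v : Fin L × Fin 2 → ℂ) : parityOp L * maj v = -(maj v * parityOp L) := by
  simp only [maj_apply, Finset.mul_sum, Finset.sum_mul, mul_smul_comm, smul_mul_assoc,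
    parityOp_mul_majorana, smul_neg, Finset.sum_neg_distrib]

theorem IsPure.gaussianUnitary_mulVec {ψ : Vec L} (hψ : IsPure ψ)
    {G : Matrix (Fin L × Fin 2) (Fin L × Fin 2) ℝ} (hG : Gᵀ = -G) :
    IsPure (gaussianUnitary G *ᵥ ψ) := by
  obtain ⟨V, hV, -⟩ := exists_gaussianUnitary_inv G
  exact hψ.mulVec hV fun p => ⟨_, by
    rw [← one_smul ℂ (majorana p), ← maj_single, gaussianUnitary_mul_maj hG]⟩

theorem IsPure.smul {ψ : Vec L} (hψ : IsPure ψ) {a : ℂ} (ha : a ≠ 0) : IsPure (a • ψ) := by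
  have := hψ.mulVec (U := a • 1) (V := a⁻¹ • 1) (by simp [smul_smul, ha])
    (fun p => ⟨Pi.single p 1, by rw [maj_single]; simp⟩)
  rwa [smul_one_mulVec] at this

theorem eq_smul_ket_of_annihilated {w : Bits L} {ψ : Vec L}
    (h : ∀ k, (createAt w k)ᴴ *ᵥ ψ = 0) : ∃ c : ℂ, ψ = c • ket w := by
  have h1 : ∀ k, annih k *ᵥ ((shiftOp w)ᴴ *ᵥ ψ) = 0 := fun k => by
    rw [Matrix.mulVec_mulVec, ← conjTranspose_shiftOp_mul (shiftOp_mul_annih w k),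
      ← Matrix.mulVec_mulVec, h, Matrix.mulVec_zero]
  have h2 := congrArg (shiftOp w *ᵥ ·) (eq_smul_vacuum h1)
  simp only [Matrix.mulVec_mulVec, shiftOp_mul_conjTranspose, Matrix.one_mulVec, Matrix.mulVec_smul,
    shiftOp_vacuum] at h2
  exact ⟨_, h2⟩

/-- The annihilators of a pure vector contain the image of those of any basis vector under a real
orthogonal matrix. -/
theorem IsPure.exists_orthogonal {ψ : Vec L} (hψ : IsPure ψ) (w : Bits L) :
    ∃ R : Matrix (Fin L × Fin 2) (Fin L × Fin 2) ℝ, Rᵀ * R = 1 ∧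
      ∀ k, maj (R.map Complex.ofReal *ᵥ modeVec k (if w k = true then -1 else 1)) *ᵥ ψ = 0 := by
  let N : Submodule ℂ (EuclideanSpace ℂ (Fin L × Fin 2)) :=
    (annihilators ψ).map (WithLp.linearEquiv 2 ℂ (Fin L × Fin 2 → ℂ)).symm.toLinearMap
  have hN : L ≤ Module.finrank ℂ N := by
    rw [LinearEquiv.finrank_map_eq]; exact hψ.2
  let u : Fin L → Fin L × Fin 2 → ℂ := fun k =>
    ((stdOrthonormalBasis ℂ N (Fin.castLE hN k) : N) : EuclideanSpace ℂ (Fin L × Fin 2)).ofLp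
  have hu (k : Fin L) : maj (u k) *ᵥ ψ = 0 := by
    obtain ⟨v, hv, hve⟩ := (stdOrthonormalBasis ℂ N (Fin.castLE hN k)).2
    simp only [u, ← hve]
    exact hv
  have horth (j k : Fin L) : star (u j) ⬝ᵥ u k = if j = k then 1 else 0 := by
    have h := (orthonormal_iff_ite.1 (stdOrthonormalBasis ℂ N).orthonormal)
      (Fin.castLE hN j) (Fin.castLE hN k)
    rw [Submodule.coe_inner, EuclideanSpace.inner_eq_star_dotProduct, dotProduct_comm] at h
    rw [h]
    simp [Fin.ext_iff]
  have hiso (j k : Fin L) : u j ⬝ᵥ u k = 0 := by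
    have h2 := congrArg (· *ᵥ ψ) (maj_anticomm (u j) (u k))
    simp only [Matrix.add_mulVec, ← Matrix.mulVec_mulVec, hu, Matrix.mulVec_zero, add_zero,
      smul_one_mulVec] at h2
    simpa [hψ.1] using h2.symm
  let ε : Fin L → ℝ := fun k => if w k = true then -1 else 1
  have hε (k : Fin L) : ε k * ε k = 1 := by simp only [ε]; split_ifs <;> norm_num
  have hs : √2 * √2 = (2 : ℝ) := Real.mul_self_sqrt (by norm_num)
  let R : Matrix (Fin L × Fin 2) (Fin L × Fin 2) ℝ := Matrix.of fun p q =>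
    if q.2 = 0 then √2 * (u q.1 p).re else ε q.1 * √2 * (u q.1 p).im
  refine ⟨R, ?_, fun k => ?_⟩
  · have h1 (j k : Fin L) : ∑ p, (u j p).re * (u k p).re - ∑ p, (u j p).im * (u k p).im = 0 := by
      have := congrArg Complex.re (hiso j k)
      simpa [dotProduct, Complex.mul_re] using this
    have h2 (j k : Fin L) : ∑ p, (u j p).re * (u k p).im + ∑ p, (u j p).im * (u k p).re = 0 := by
      have := congrArg Complex.im (hiso j k)
      simpa [dotProduct, Complex.mul_im, Finset.sum_add_distrib] using this
    have h3 (j k : Fin L) : ∑ p, (u j p).re * (u k p).re + ∑ p, (u j p).im * (u k p).im =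
        if j = k then 1 else 0 := by
      have := congrArg Complex.re (horth j k)
      simpa [dotProduct, Complex.mul_re, Finset.sum_add_distrib, apply_ite] using this
    have h4 (j k : Fin L) : ∑ p, (u j p).re * (u k p).im - ∑ p, (u j p).im * (u k p).re = 0 := by
      have := congrArg Complex.im (horth j k)
      simpa [dotProduct, Complex.mul_im, Finset.sum_add_distrib, apply_ite, sub_eq_add_neg]
        using this
    have hmul (c d : ℝ) (f g : Fin L × Fin 2 → ℝ) :
        ∑ p, c * f p * (d * g p) = c * d * ∑ p, f p * g p := by
      rw [Finset.mul_sum]; exact Finset.sum_congr rfl fun p _ => by ring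
    have hR' (j k : Fin L) (a b : Fin 2) : ∑ p, R p (j, a) * R p (k, b) =
        if j = k then (if a = b then 1 else 0) else 0 := by
      have e1 := h1 j k
      have e2 := h2 j k
      have e3 := h3 j k
      have e4 := h4 j k
      fin_cases a <;> fin_cases b <;>
        simp only [R, Matrix.of_apply, Fin.zero_eta, Fin.mk_one, one_ne_zero, zero_ne_one, if_true,
          if_false, ite_self, hmul]
      · rw [hs]; linarith
      · rw [show ∑ p, (u j p).re * (u k p).im = 0 by linarith, mul_zero]
      · rw [show ∑ p, (u j p).im * (u k p).re = 0 by linarith, mul_zero]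
      · split_ifs at e3 ⊢ with hjk
        · subst hjk
          linear_combination ε j * ε j * (e3 - e1) + hε j +
            (∑ p, (u j p).im * (u j p).im) * (ε j * ε j) * (hs)
        · linear_combination ε j * ε k * (e3 - e1) +
            (∑ p, (u j p).im * (u k p).im) * (ε j * ε k) * (hs)
    ext ⟨j, a⟩ ⟨k, b⟩
    rw [Matrix.mul_apply]
    simp only [Matrix.transpose_apply, hR', Matrix.one_apply, Prod.mk.injEq]
    split_ifs <;> simp_all
  · have : R.map Complex.ofReal *ᵥ modeVec k (if w k = true then -1 else 1) =
        ((√2 / 2 : ℝ) : ℂ) • u k := by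
      have hεc : (if w k = true then -1 else 1 : ℂ) = ε k := by
        simp only [ε]; split_ifs <;> simp
      have hεk : (ε k : ℂ) * ε k = 1 := by exact_mod_cast hε k
      rw [modeVec, Matrix.mulVec_add, hεc]
      funext p
      simp only [Pi.add_apply, Matrix.mulVec_single, Matrix.col_apply, Matrix.map_apply, R,
        Matrix.of_apply, Pi.smul_apply, MulOpposite.smul_eq_mul_unop, MulOpposite.unop_op,
        if_true, one_ne_zero, if_false, smul_eq_mul]
      conv_rhs => rw [← Complex.re_add_im (u k p)]
      push_cast
      linear_combination ((√2 : ℂ) * (u k p).im * (Complex.I / 2)) * hεk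
    rw [this, map_smul, Matrix.smul_mulVec, hu, smul_zero]

theorem maj_mul_self_of_unit {v : Fin L × Fin 2 → ℝ} (hv : v ⬝ᵥ v = 1) :
    (maj (fun p => (v p : ℂ)) : Op L) * maj (fun p => (v p : ℂ)) = 1 := by
  have h2 := maj_anticomm (fun p => (v p : ℂ)) (fun p => (v p : ℂ))
  have h3 : (fun p => (v p : ℂ)) ⬝ᵥ (fun p => (v p : ℂ)) = 1 := by
    simp only [dotProduct] at hv ⊢
    exact_mod_cast hv
  rw [h3, mul_one, ← two_smul ℂ] at h2
  exact smul_right_injective _ (two_ne_zero : (2 : ℂ) ≠ 0) h2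

theorem maj_reflection {v : Fin L × Fin 2 → ℝ} (hv : v ⬝ᵥ v = 1) (u : Fin L × Fin 2 → ℂ) :
    maj u * maj (fun p => (v p : ℂ)) =
      -(maj (fun p => (v p : ℂ)) * maj ((refl v).map Complex.ofReal *ᵥ u)) := by
  have h1 := maj_anticomm u (fun p => (v p : ℂ))
  have hr : (refl v).map Complex.ofReal *ᵥ u =
      u - (2 * (u ⬝ᵥ fun p => (v p : ℂ))) • fun p => (v p : ℂ) := by
    have : (refl v).map Complex.ofReal = 1 - (2 : ℂ) • Matrix.vecMulVec
        (fun p => (v p : ℂ)) (fun p => (v p : ℂ)) := by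
      ext i j
      by_cases h : i = j <;> simp [refl, Matrix.vecMulVec_apply, h]
    rw [this, Matrix.sub_mulVec, Matrix.one_mulVec, Matrix.smul_mulVec, Matrix.vecMulVec_mulVec,
      dotProduct_comm]
    simp [smul_smul]
  rw [hr, map_sub, map_smul, mul_sub, mul_smul_comm, maj_mul_self_of_unit hv, ← h1]
  abel

/-- Every pure vector of definite parity is Gaussian with respect to any reference of the same
parity. -/
theorem IsPure.exists_gaussian {ψ : Vec L} (hψ : IsPure ψ) {w : Bits L}
    (hpar : parityOp L *ᵥ ψ = ((-1 : ℂ) ^ weight w) • ψ) :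
    ∃ (a : ℂ) (φ : Vec L), a ≠ 0 ∧ IsGaussianFrom w φ ∧ ψ = a • φ := by
  obtain ⟨R, hR, hkill⟩ := hψ.exists_orthogonal w
  obtain ⟨G, hG, -, hRG⟩ := exists_exp_or_exp_mul_refl hR
  obtain ⟨V, hVU, hUV⟩ := exists_gaussianUnitary_inv G
  have hV (v : Fin L × Fin 2 → ℂ) :
      maj v * V = V * maj ((NormedSpace.exp G).map Complex.ofReal *ᵥ v) := by
    calc maj v * V = V * (gaussianUnitary G * maj v) * V := by
          rw [← mul_assoc, hVU, one_mul]
      _ = _ := by rw [gaussianUnitary_mul_maj hG, mul_assoc, mul_assoc, hUV, mul_one]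
  have hψV : ψ = gaussianUnitary G *ᵥ (V *ᵥ ψ) := by
    rw [Matrix.mulVec_mulVec, hUV, Matrix.one_mulVec]
  rcases hRG with hRG | ⟨v, hv, -, -, hRG⟩
  · obtain ⟨c, hc⟩ := eq_smul_ket_of_annihilated (w := w) (ψ := V *ᵥ ψ) fun k => by
      rw [createAt_conjTranspose_eq_maj, Matrix.mulVec_mulVec, hV, hRG, ← Matrix.mulVec_mulVec,
        hkill, Matrix.mulVec_zero]
    rw [hc, Matrix.mulVec_smul] at hψV
    refine ⟨c, _, fun h0 => hψ.1 ?_, ⟨G, hG, rfl⟩, hψV⟩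
    rw [hψV, h0, zero_smul]
  · exfalso
    set m : Op L := maj (fun p => (v p : ℂ)) with hm
    have hmm : m * m = 1 := maj_mul_self_of_unit hv
    obtain ⟨c, hc⟩ := eq_smul_ket_of_annihilated (w := w) (ψ := m *ᵥ (V *ᵥ ψ)) fun k => by
      rw [createAt_conjTranspose_eq_maj, Matrix.mulVec_mulVec, maj_reflection hv, Matrix.neg_mulVec,
        ← Matrix.mulVec_mulVec, Matrix.mulVec_mulVec _ _ V, hV, Matrix.mulVec_mulVec]
      have : R.map Complex.ofReal =
          (NormedSpace.exp G).map Complex.ofReal * (refl v).map Complex.ofReal := by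
        rw [← hRG]
        exact map_mul Complex.ofRealHom.mapMatrix _ _
      have h1 := hkill k
      rw [this, ← Matrix.mulVec_mulVec] at h1
      rw [← Matrix.mulVec_mulVec, ← Matrix.mulVec_mulVec, h1, Matrix.mulVec_zero,
        Matrix.mulVec_zero, neg_zero]
    have h1 : V *ᵥ ψ = c • (m *ᵥ ket w) := by
      rw [← Matrix.mulVec_smul, ← hc, Matrix.mulVec_mulVec, hmm, Matrix.one_mulVec]
    have h2 : parityOp L *ᵥ ψ = -(((-1 : ℂ) ^ weight w) • ψ) := by
      rw [hψV, h1, Matrix.mulVec_mulVec, (parityOp_commute_gaussianUnitary G).eq,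
        ← Matrix.mulVec_mulVec, Matrix.mulVec_smul (parityOp L), Matrix.mulVec_mulVec,
        parityOp_mul_maj, Matrix.neg_mulVec, ← Matrix.mulVec_mulVec, parityOp_mulVec_ket]
      simp only [Matrix.mulVec_smul, Matrix.mulVec_neg, smul_neg]
      rw [smul_comm]
    rw [hpar] at h2
    have h3 : (2 : ℂ) • (((-1 : ℂ) ^ weight w) • ψ) = 0 := by
      rw [two_smul]; nth_rewrite 1 [h2]; rw [neg_add_cancel]
    exact hψ.1 (by simpa using h3)

/-! ### Matchgate tensors and Gaussian vectors -/

theorem parityOp_commute_quadForm_createAt (A : Matrix (Fin L) (Fin L) ℂ) (z : Bits L) :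
    Commute (parityOp L) (quadForm A (createAt z)) := by
  refine Commute.smul_right (Commute.sum_right _ _ _ fun p _ => Commute.sum_right _ _ _ fun q _ =>
    Commute.smul_right ?_ _) _
  rw [Commute, SemiconjBy, createAt_eq_maj, createAt_eq_maj, ← mul_assoc, parityOp_mul_maj, neg_mul,
    mul_assoc, parityOp_mul_maj, mul_neg, neg_neg, mul_assoc]

theorem IsGaussian.isPure {ψ : Vec L} (hψ : IsGaussian ψ) : IsPure ψ := by
  obtain ⟨G, hG, rfl⟩ := hψ
  exact isPure_vacuum.gaussianUnitary_mulVec hG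

theorem IsGaussianFrom.parity {w : Bits L} {ψ : Vec L} (hψ : IsGaussianFrom w ψ) :
    parityOp L *ᵥ ψ = ((-1 : ℂ) ^ weight w) • ψ := by
  obtain ⟨G, hG, rfl⟩ := hψ
  rw [Matrix.mulVec_mulVec, (parityOp_commute_gaussianUnitary G).eq, ← Matrix.mulVec_mulVec,
    parityOp_mulVec_ket, Matrix.mulVec_smul]

/-- The amplitudes of a pure vector relative to a basis vector that it overlaps are Pfaffians. -/
theorem IsPure.exists_pfaffian {ψ : Vec L} (hψ : IsPure ψ) {z : Bits L} (hz : ψ z ≠ 0) :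
    ∃ A : Matrix (Fin L) (Fin L) ℂ, Aᵀ = -A ∧
      ∀ x, ((shiftOp z)ᴴ *ᵥ ψ) x = ψ z * pfAt A x := by
  have h0 : ((shiftOp z)ᴴ *ᵥ ψ) (zeros L) = ψ z := by simp [shiftOp_conjTranspose_mulVec]
  obtain ⟨A, hA, h⟩ := (hψ.conjTranspose_shiftOp_mulVec z).exists_antisymm (by rwa [h0])
  exact ⟨A, hA, fun x => by rw [apply_eq_pfAt h x, h0]⟩

/-- Vectors with Pfaffian amplitudes relative to a basis vector are pure. -/
theorem isPure_of_pfaffian {ψ : Vec L} (hψ : ψ ≠ 0) {z : Bits L} {A : Matrix (Fin L) (Fin L) ℂ}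
    (hA : Aᵀ = -A) (h : ∀ x, ((shiftOp z)ᴴ *ᵥ ψ) x = ψ z * pfAt A x) : IsPure ψ := by
  have h0 : ((shiftOp z)ᴴ *ᵥ ψ) (zeros L) = ψ z := by simp [shiftOp_conjTranspose_mulVec]
  have h1 := (pfaffian_iff_exp hA ((shiftOp z)ᴴ *ᵥ ψ)).1 (by rwa [h0])
  have h2 : ψ = shiftOp z *ᵥ ((shiftOp z)ᴴ *ᵥ ψ) := by
    rw [Matrix.mulVec_mulVec, shiftOp_mul_conjTranspose, Matrix.one_mulVec]
  have hz : ψ z ≠ 0 := fun hz => hψ (by rw [h2, h1, h0, hz, zero_smul, Matrix.mulVec_zero])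
  rw [h2, h1, h0]
  exact ((isPure_exp_quadForm hA).smul hz).shiftOp_mulVec z

theorem offset_matchgate_exists_gaussian {z w : Bits L} {A : Matrix (Fin L) (Fin L) ℂ}
    {T : Tensor L} (hzw : Even (weight z) ↔ Even (weight w)) (hT : IsMatchgateWith A (zeros L) T)
    (hT0 : T ≠ 0) :
    ∃ (a : ℂ) (φ : Vec L), a ≠ 0 ∧ IsGaussianFrom w φ ∧ ∑ x, T x • offsetKet z x = a • φ := by
  obtain ⟨hA, hT⟩ := hT
  simp only [bxor_zeros] at hT
  have hTz : T (zeros L) ≠ 0 := fun h => hT0 (funext fun x => by rw [hT, h, mul_zero]; rfl)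
  set ψ : Vec L := ∑ x, T x • offsetKet z x with hψ
  have hW : (shiftOp z)ᴴ *ᵥ ψ = fun x => revSign x * T x := by
    rw [hψ, sum_smul_offsetKet, Matrix.mulVec_mulVec, conjTranspose_mul_shiftOp, Matrix.one_mulVec]
  have hoff : offsetTensor z ψ = T := by
    funext x
    rw [offsetTensor_eq, hW, ← mul_assoc, revSign_mul_self, one_mul]
  have hψz : ψ z = T (zeros L) := by rw [← offsetTensor_zeros z ψ, hoff]
  have hψ0 : ψ ≠ 0 := fun h => hTz (by rw [← hψz, h]; rfl)
  have hpf : ∀ x, offsetTensor z ψ x = offsetTensor z ψ (zeros L) * pfAt A x := fun x => by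
    rw [hoff, hT, mul_comm]
  have hpure : IsPure ψ := by
    refine isPure_of_pfaffian hψ0 (z := z) (A := -A) (by rw [Matrix.transpose_neg, hA]) fun x => ?_
    rw [offsetTensor_pfaffian_iff.1 hpf x, hW, hψz]
    simp
  have hpar : parityOp L *ᵥ ψ = ((-1 : ℂ) ^ weight w) • ψ := by
    have hs : (-1 : ℂ) ^ weight z = (-1) ^ weight w := by
      rcases Nat.even_or_odd (weight z) with h | h
      · rw [h.neg_one_pow, (hzw.1 h).neg_one_pow]
      · have h' : Odd (weight w) :=
          Nat.not_even_iff_odd.1 fun h' => Nat.not_even_iff_odd.2 h (hzw.2 h')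
        rw [h.neg_one_pow, h'.neg_one_pow]
    rw [(offset_pfaffian_iff_exp hA z ψ).1 hpf, Matrix.mulVec_smul, Matrix.mulVec_mulVec,
      (parityOp_commute_quadForm_createAt A z).neg_right.exp_right.eq, ← Matrix.mulVec_mulVec,
      parityOp_mulVec_ket, Matrix.mulVec_smul, hs, smul_comm]
  exact hpure.exists_gaussian hpar

theorem parity_eq_self_iff_isEvenTensor (T : Tensor L) :
    parityOp L *ᵥ T = T ↔ IsEvenTensor T := by
  constructor
  · intro h x hx
    have := congrFun h x
    rw [parityOp_mulVec, hx.neg_one_pow] at this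
    linear_combination (-1 / 2 : ℂ) * this
  · intro h
    funext x
    rw [parityOp_mulVec]
    rcases Nat.even_or_odd (weight x) with hx | hx
    · rw [hx.neg_one_pow, one_mul]
    · rw [h x hx, mul_zero]

theorem pfAt_refSign_scale (A : Matrix (Fin L) (Fin L) ℂ) (z x : Bits L) :
    pfAt (Matrix.of fun i j => jwSign i z * A i j * jwSign j z) x = refSign z x * pfAt A x :=
  pfAt_scale A (fun k => jwSign k z) x

theorem transpose_scale {A : Matrix (Fin L) (Fin L) ℂ} (hA : Aᵀ = -A) (d : Fin L → ℂ) :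
    (Matrix.of fun i j => d i * A i j * d j)ᵀ = -Matrix.of fun i j => d i * A i j * d j := by
  ext i j
  have : A j i = -A i j := congrFun (congrFun hA i) j
  simp only [Matrix.transpose_apply, Matrix.neg_apply, Matrix.of_apply, this]
  ring

/-- The nonzero matchgate tensors are the coefficient tensors of pure vectors. -/
theorem isMatchgate_iff_isPure {T : Tensor L} (hT : T ≠ 0) : IsMatchgate T ↔ IsPure T := by
  constructor
  · rintro ⟨z, A, hA, h⟩
    refine isPure_of_pfaffian hT (z := z) (transpose_scale hA fun k => jwSign k z) fun x => ?_
    rw [pfAt_refSign_scale, shiftOp_conjTranspose_mulVec, h (bxor x z), bxor_bxor_cancel]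
    ring
  · intro hp
    obtain ⟨z, hz⟩ := Function.ne_iff.1 hT
    obtain ⟨A, hA, h⟩ := hp.exists_pfaffian hz
    refine ⟨z, _, transpose_scale hA fun k => jwSign k z, fun x => ?_⟩
    have h1 := h (bxor x z)
    rw [shiftOp_conjTranspose_mulVec, bxor_bxor_cancel] at h1
    rw [pfAt_refSign_scale]
    have h2 := refSign_mul_self z (bxor x z)
    linear_combination refSign z (bxor x z) * h1 - T x * h2

end Matchgate

open Matchgate in
theorem mainTheorem1 (L : ℕ) :
    -- a Gaussian state vector has a basis state with nonzero overlap, and for each such basis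
    -- state the amplitude tensor in the offset basis is a matchgate with reference index `0`,
    -- and the state is a quadratic exponential above `|z⟩`
    (∀ ψ : Vec L, IsGaussian ψ →
      (∃ z, braket (ket z) ψ ≠ 0) ∧
      ∀ z, braket (ket z) ψ ≠ 0 →
        ψ = ∑ x, offsetTensor z ψ x • offsetKet z x ∧
        offsetTensor z ψ (zeros L) ≠ 0 ∧
        ∃ A : Matrix (Fin L) (Fin L) ℂ,
          IsMatchgateWith A (zeros L) (offsetTensor z ψ) ∧
          (∀ x, offsetTensor z ψ x = offsetTensor z ψ (zeros L) * pfAt A x) ∧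
          ψ = braket (ket z) ψ •
            (NormedSpace.exp (-quadForm A (createAt z)) *ᵥ ket z)) ∧
    -- Pfaffian amplitudes are equivalent to the exponential form above the reference `|z⟩`
    (∀ (z : Bits L) (ψ : Vec L) (A : Matrix (Fin L) (Fin L) ℂ), Aᵀ = -A →
      ((∀ x, offsetTensor z ψ x = offsetTensor z ψ (zeros L) * pfAt A x) ↔
        ψ = braket (ket z) ψ •
          (NormedSpace.exp (-quadForm A (createAt z)) *ᵥ ket z))) ∧
    -- the same above the vacuum, for the amplitudes in the occupation basis
    (∀ (ψ : Vec L) (A : Matrix (Fin L) (Fin L) ℂ), Aᵀ = -A →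
      ((∀ x, braket (ket x) ψ = braket (ket (zeros L)) ψ * pfAt A x) ↔
        ψ = braket (ket (zeros L)) ψ •
          (NormedSpace.exp (quadForm A create) *ᵥ ket (zeros L)))) ∧
    -- converse: nonzero matchgate tensors in an offset basis give Gaussian states
    (∀ (z w : Bits L) (A : Matrix (Fin L) (Fin L) ℂ) (T : Tensor L),
      (Even (weight z) ↔ Even (weight w)) →
      IsMatchgateWith A (zeros L) T → T ≠ 0 →
        ∃ (a : ℂ) (φ : Vec L), a ≠ 0 ∧ IsGaussianFrom w φ ∧
          ∑ x, T x • offsetKet z x = a • φ) ∧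
    -- in the occupation basis, the nonzero even matchgate tensors are exactly the coefficient
    -- tensors of nonzero multiples of Gaussian state vectors
    (∀ T : Tensor L, T ≠ 0 →
      ((IsMatchgate T ∧ IsEvenTensor T) ↔
        ∃ (a : ℂ) (φ : Vec L), a ≠ 0 ∧ IsGaussian φ ∧ ∑ x, T x • ket x = a • φ)) := by
  refine ⟨fun ψ hψ => ?_, fun z ψ A hA => ?_, fun ψ A hA => ?_,
    fun z w A T hzw hT hT0 => offset_matchgate_exists_gaussian hzw hT hT0, fun T hT => ?_⟩
  · have hpure := IsGaussian.isPure hψ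
    simp only [braket_ket]
    refine ⟨Function.ne_iff.1 hpure.1, fun z hz => ?_⟩
    obtain ⟨A, hA, h⟩ := hpure.exists_pfaffian hz
    have hA' : (-A)ᵀ = -(-A) := by rw [Matrix.transpose_neg, hA]
    have h0 : ((shiftOp z)ᴴ *ᵥ ψ) (zeros L) = ψ z := by simp [shiftOp_conjTranspose_mulVec]
    have hpf : ∀ x, offsetTensor z ψ x = offsetTensor z ψ (zeros L) * pfAt (-A) x :=
      offsetTensor_pfaffian_iff.2 fun x => by rw [h, h0, neg_neg]
    refine ⟨(sum_offsetTensor_smul z ψ).symm, by rwa [offsetTensor_zeros], -A,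
      ⟨hA', fun x => ?_⟩, hpf, (offset_pfaffian_iff_exp hA' z ψ).1 hpf⟩
    rw [bxor_zeros, hpf, mul_comm]
  · rw [braket_ket]
    exact offset_pfaffian_iff_exp hA z ψ
  · simp only [braket_ket]
    exact pfaffian_iff_exp hA ψ
  · rw [sum_smul_ket, isMatchgate_iff_isPure hT, ← parity_eq_self_iff_isEvenTensor]
    constructor
    · rintro ⟨hp, hpar⟩
      exact hp.exists_gaussian (by rw [hpar, weight_zeros, pow_zero, one_smul])
    · rintro ⟨a, φ, ha, hφ, rfl⟩
      refine ⟨(IsGaussian.isPure hφ).smul ha, ?_⟩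
      rw [Matrix.mulVec_smul, IsGaussianFrom.parity hφ, weight_zeros, pow_zero, one_smul]
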